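/- Consider the following frog model on $\mathbb{Z}$. Let $(\lambda_j)_{j\ge 1}$ and $(a_j)_{j\ge 1}$ be real sequences with $\lambda_j>0$ and $0<a_j<\tfrac12$, and suppose that the sequences $(\lambda_j)_{j\ge1}$ and $(1/a_j)_{j\ge1}$ are both concave, i.e. $u_j+u_{j+2}\le 2u_{j+1}$ for all $j\ge 1$. Put $p_j=\tfrac12+a_j$ for $j\ge1$ and let $p_0\in(\tfrac12,1)$ be arbitrary. Initially there is one active frog at the origin, for each $j\ge 1$ there are $X_j\sim\mathrm{Poisson}(\lambda_j)$ sleeping frogs at the site $j$, where the $X_j$ are independent, and there are no frogs at negative sites. In discrete time, each active frog that started at $j\ge0$ performs a nearest-neighbour random walk, stepping to the left with probability $p_j$ and to the right with probability $1-p_j$; all walks are independent of each other and of the $X_j$. Whenever an active frog lands on a site with sleeping frogs, all of these become active and start their own walks. The model is called transient if the probability that infinitely many distinct frogs hit the origin is $0$. Then the model is transient if and only if $$\sum_{n=1}^{\infty}\exp\Big(-\lambda_n\Big(\frac{1}{4a_n}-\frac12\Big)\Big)=\infty .$$ -/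

import Mathlib

open MeasureTheory ProbabilityTheory

namespace FrogModel

/-- A frog is labelled by the site `j ≥ 0` where it starts and by its number `i` among the frogs
starting there. -/
abbrev Frog : Type := ℕ × ℕ

/-- The randomness of the model: `ω.1 j` is the number of frogs asleep at the site `j ≥ 1`
(the coordinate `ω.1 0` is not used), and `ω.2 (f, s)` is the displacement made by the frog `f` in
the `s`-th step after its activation. -/
abbrev Sample : Type := (ℕ → ℕ) × (Frog × ℕ → ℤ)

/-- The law of the randomness. All coordinates are independent, `ν j` is the law of the number of
frogs at `j`, and each step of a frog started at `j` is `-1` with probability `p j` and `+1` with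
probability `1 - p j`. -/
noncomputable def law (ν : ℕ → Measure ℕ) (p : ℕ → unitInterval) : Measure Sample :=
  (Measure.infinitePi ν).prod
    (Measure.infinitePi fun c : Frog × ℕ => bernoulliMeasure (-1 : ℤ) 1 (p c.1.1))

/-- The number of frogs initially at site `j`: one (active) frog at the origin, and the random
number of sleeping frogs at `j ≥ 1`. There are no frogs at negative sites. -/
def count (ω : Sample) (j : ℕ) : ℕ := if j = 0 then 1 else ω.1 j

/-- The position of the frog `f` once it has made `k` steps after its activation. -/
def walk (ω : Sample) (f : Frog) (k : ℕ) : ℤ := (f.1 : ℤ) + ∑ s ∈ Finset.range k, ω.2 (f, s)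

open Classical in
/-- The dynamics in discrete time. `age ω t f` is `none` if at time `t` the frog `f` is not active
(or does not exist), and `some k` if it is active and has made `k` steps. At time `0` only the frog
at the origin is active. From time `t` to `t + 1` each active frog makes one step, and then each
sleeping frog whose site an active frog has landed on becomes active. -/
noncomputable def age (ω : Sample) : ℕ → Frog → Option ℕ
  | 0, f => if f = (0, 0) then some 0 else none
  | t + 1, f =>
    match age ω t f with
    | some k => some (k + 1)
    | none =>
      if f.2 < count ω f.1 ∧ ∃ g k, age ω t g = some k ∧ walk ω g (k + 1) = (f.1 : ℤ)
      then some 0 else none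

/-- The frog `f` is at the origin at some time at which it is active. -/
def HitsOrigin (ω : Sample) (f : Frog) : Prop :=
  ∃ t k, age ω t f = some k ∧ walk ω f k = 0

/-- The model is transient if the probability that infinitely many frogs hit the origin is `0`. -/
def Transient (ν : ℕ → Measure ℕ) (p : ℕ → unitInterval) : Prop :=
  law ν p {ω | {f : Frog | HitsOrigin ω f}.Infinite} = 0

/-- Concavity of a real sequence `u 1, u 2, u 3, …` (the value `u 0` is not used). -/
def ConcaveSeq (u : ℕ → ℝ) : Prop :=
  ∀ j, 1 ≤ j → u j + u (j + 2) ≤ 2 * u (j + 1)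

end FrogModel

/-! Walks drift to the left, so a frog from `j` has a finite maximal displacement to the right, and
it is geometric: it reaches `k` with probability `r_j ^ k`, where `r_j = (1 - p_j) / p_j`
(`measureReal_reach`). Only the largest such displacement over the frogs of a site, the range of the
site, matters. The ranges are independent (`map_range_law`). Call `m` a barrier if no range from `0,
…, m` leads beyond `m`. A barrier confines the activation to finitely many frogs; without barriers
every frog wakes up, and the drift brings it to the origin. So, almost surely, infinitely many frogs
hit the origin exactly when there is no barrier.

Poisson thinning makes the probability of a barrier for the sites `j ≥ 1` equal to `exp
(-reachMean)`. If these probabilities have a finite sum, a union bound over far barriers and an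
independent long range at the origin exclude all barriers with positive probability. If the sum is
infinite, decompose according to the last barrier: as the ranges increase stochastically, having no
further barrier is at least as likely after a barrier as at the start, and disjointness of these
events forces probability zero (`infinitePi_noBarrier_eq_zero`).

It remains to compare series. With `x = r / (1 - r) = 1 / (4 a) - 1 / 2`, monotonicity gives
`reachMean ≤ l x`. Concavity gives `u (n - i) ≥ (1 - i / n) u n`, hence a converse bound with a
bounded error, except for indices whose terms are summable anyway (`summable_exp_neg_reachMean`). -/

namespace FrogModel

/-! ### Concave sequences and the comparison of the two series. -/

section ConcaveSequences

/-- A positive concave sequence of reals. -/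
structure PosConcave (u : ℕ → ℝ) : Prop where
  pos : ∀ j, 0 < u j
  concave : ∀ j, u j + u (j + 2) ≤ 2 * u (j + 1)

namespace PosConcave

variable {u : ℕ → ℝ}

lemma increment_antitone (hu : PosConcave u) : Antitone fun j => u (j + 1) - u j :=
  antitone_nat_of_succ_le fun j => by
    have := hu.concave j
    show u (j + 1 + 1) - u (j + 1) ≤ u (j + 1) - u j
    linarith

/-- A negative increment would bound all later increments and drive the sequence below zero. -/
lemma monotone (hu : PosConcave u) : Monotone u := by
  refine monotone_nat_of_le_succ fun n => ?_
  by_contra! h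
  have hk : ∀ k : ℕ, u (n + k) ≤ u n + k * (u (n + 1) - u n) := by
    intro k
    induction k with
    | zero => simp
    | succ k ih =>
      have := hu.increment_antitone (Nat.le_add_right n k)
      simp only at this
      rw [← add_assoc]
      push_cast
      linarith
  obtain ⟨k, hk'⟩ := exists_nat_gt (u n / (u n - u (n + 1)))
  rw [div_lt_iff₀ (by linarith)] at hk'
  have := hk k
  have := hu.pos (n + k)
  linarith

/-- The `n` earlier increments are all at least the next one, and they sum to `u n - u 0 < u n`. -/
lemma mul_increment_le (hu : PosConcave u) (n : ℕ) : n * (u (n + 1) - u n) ≤ u n := by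
  induction n with
  | zero => simpa using (hu.pos 0).le
  | succ n ih =>
    have := hu.increment_antitone (Nat.le_succ n)
    simp only [Nat.succ_eq_add_one] at this
    have h2 : ((n : ℝ) + 1) * (u (n + 1 + 1) - u (n + 1)) ≤ ((n : ℝ) + 1) * (u (n + 1) - u n) := by
      gcongr
    push_cast
    linarith

/-- Slopes of chords from the origin decrease; the product form allows `m = 0`. -/
lemma mul_le_mul (hu : PosConcave u) {m n : ℕ} (h : m ≤ n) : m * u n ≤ n * u m := by
  induction n, h using Nat.le_induction with
  | base => exact le_rfl
  | succ n h ih =>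
    rcases Nat.eq_zero_or_pos n with rfl | hn
    · obtain rfl : m = 0 := by omega
      simpa using (hu.pos 0).le
    · have h1 := hu.mul_increment_le n
      have hn' : (0 : ℝ) < n := by exact_mod_cast hn
      have h2 : (n : ℝ) * u (n + 1) ≤ (n + 1) * u n := by linarith
      have h3 : (m : ℝ) * (n * u (n + 1)) ≤ m * ((n + 1) * u n) := by gcongr
      have h4 : ((n : ℝ) + 1) * (m * u n) ≤ (n + 1) * (n * u m) := by gcongr
      refine le_of_mul_le_mul_left (a := (n : ℝ)) ?_ hn'
      push_cast
      linarith

lemma ratio_mul_le (hu : PosConcave u) {i n : ℕ} (h : i ≤ n) (hn : 0 < n) :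
    (1 - i / n) * u n ≤ u (n - i) := by
  have h1 := hu.mul_le_mul (Nat.sub_le n i)
  have hn' : (0 : ℝ) < n := by exact_mod_cast hn
  rw [Nat.cast_sub h] at h1
  rw [one_sub_div hn'.ne', div_mul_eq_mul_div, div_le_iff₀ hn']
  linarith

end PosConcave

/-- The expected number of frogs from the sites `0, …, n` that ever reach the site `n + 1`, when
there are `l j` frogs at `j` on average, which move one step further to the right with probability
`x j / (1 + x j)`. -/
noncomputable def reachMean (l x : ℕ → ℝ) (n : ℕ) : ℝ :=
  ∑ i ∈ Finset.range (n + 1), l (n - i) * (x (n - i) / (1 + x (n - i))) ^ (i + 1)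

variable {l x : ℕ → ℝ}

lemma ratio_le_ratio {y z : ℝ} (hy : 0 < y) (h : y ≤ z) : y / (1 + y) ≤ z / (1 + z) := by
  rw [div_le_div_iff₀ (by linarith) (by linarith)]
  linarith

lemma mul_ratio_le_ratio {y z t : ℝ} (hz : 0 < z) (hy : 0 < y) (ht : t ≤ 1)
    (h : t * z ≤ y) : t * (z / (1 + z)) ≤ y / (1 + y) := by
  rw [← mul_div_assoc, div_le_div_iff₀ (by linarith) (by linarith)]
  have : t * z * y ≤ 1 * z * y := by gcongr
  linarith

lemma hasSum_ratio_pow {y : ℝ} (hy : 0 < y) : HasSum (fun i : ℕ => (y / (1 + y)) ^ (i + 1)) y := by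
  have h1 : y / (1 + y) < 1 := by rw [div_lt_one (by linarith)]; linarith
  have h := (hasSum_geometric_of_lt_one (by positivity) h1).mul_left (y / (1 + y))
  have e : y / (1 + y) * (1 - y / (1 + y))⁻¹ = y := by
    field_simp
    ring
  rw [e] at h
  simpa [pow_succ'] using h

lemma hasSum_choose_ratio_pow {y : ℝ} (hy : 0 < y) :
    HasSum (fun i : ℕ => ((i + 1 : ℝ) * (i + 2)) * (y / (1 + y)) ^ (i + 1))
      (2 * y * (1 + y) ^ 2) := by
  have h1 : y / (1 + y) < 1 := by rw [div_lt_one (by linarith)]; linarith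
  have h0 : 0 ≤ y / (1 + y) := by positivity
  have h := (hasSum_choose_mul_geometric_of_norm_lt_one 2 (r := y / (1 + y))
    (by rwa [Real.norm_of_nonneg h0])).mul_left (2 * (y / (1 + y)))
  have hv : 2 * (y / (1 + y)) * (1 / (1 - y / (1 + y)) ^ (2 + 1)) = 2 * y * (1 + y) ^ 2 := by
    have : 1 - y / (1 + y) = 1 / (1 + y) := by field_simp; ring
    rw [this, div_pow, one_pow, one_div_one_div]
    field_simp
  rw [hv] at h
  refine h.congr_fun fun i => ?_
  have : (((i + 2 : ℕ).choose 2 : ℕ) : ℝ) = (i + 2) * (i + 1) / 2 := by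
    rw [Nat.cast_choose_two]
    push_cast
    ring
  rw [this]
  ring

lemma reachMean_le (hl : PosConcave l) (hx : PosConcave x) (n : ℕ) :
    reachMean l x n ≤ l n * x n := by
  have h1 : reachMean l x n ≤ ∑ i ∈ Finset.range (n + 1), l n * (x n / (1 + x n)) ^ (i + 1) := by
    refine Finset.sum_le_sum fun i _ => ?_
    have := hx.pos (n - i)
    have := hl.pos n
    gcongr ?_ * ?_ ^ _
    · exact hl.monotone (Nat.sub_le _ _)
    · exact ratio_le_ratio (hx.pos _) (hx.monotone (Nat.sub_le _ _))
  refine h1.trans ?_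
  rw [← Finset.mul_sum]
  have hn := hx.pos n
  gcongr
  · exact (hl.pos n).le
  · exact sum_le_hasSum _ (fun i _ => by positivity) (hasSum_ratio_pow hn)

/-- Going back `i` sites costs a factor at most `t = 1 - i / n` in `l` and in each of the `i + 1`
ratios. Bernoulli's inequality linearises `t ^ (i + 2)`, and the resulting series are summed in
closed form. -/
lemma mul_one_sub_le_reachMean (hl : PosConcave l) (hx : PosConcave x) {n : ℕ} (hn : 0 < n) :
    l n * x n * (1 - 2 * (1 + x n) ^ 2 / n) ≤ reachMean l x n := by
  have hn' : (0 : ℝ) < n := by exact_mod_cast hn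
  have hxn := hx.pos n
  have hln := hl.pos n
  set r := x n / (1 + x n) with hr
  have hr0 : 0 ≤ r := by positivity
  have h1 : ∀ i ∈ Finset.range (n + 1), l n * (1 - (i + 1) * (i + 2) / n) * r ^ (i + 1) ≤
      l (n - i) * (x (n - i) / (1 + x (n - i))) ^ (i + 1) := by
    intro i hi
    have hin : i ≤ n := by simpa [Nat.lt_succ_iff] using hi
    have hin' : (i : ℝ) / n ≤ 1 := by
      rw [div_le_one hn']; exact_mod_cast hin
    set t : ℝ := 1 - i / n with ht
    have ht0 : 0 ≤ t := by linarith
    have ht1 : t ≤ 1 := by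
      have : (0 : ℝ) ≤ i / n := by positivity
      linarith
    -- Bernoulli gives `i (i + 2)`; the larger `(i + 1) (i + 2)` fits the binomial series.
    have hb : 1 - ((i : ℝ) + 1) * (i + 2) / n ≤ t ^ (i + 2) := by
      have h := one_add_mul_le_pow (a := -(i / n : ℝ)) (by linarith) (i + 2)
      have e : 1 + -(i / n : ℝ) = t := by rw [ht]; ring
      rw [e] at h
      refine le_trans ?_ h
      push_cast
      have : (0 : ℝ) ≤ (i + 2) / n := by positivity
      have e2 : ((i : ℝ) + 1) * (i + 2) / n = (i + 2) * (i / n) + (i + 2) / n := by ring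
      rw [e2]
      linarith
    calc l n * (1 - (i + 1) * (i + 2) / n) * r ^ (i + 1)
        ≤ l n * t ^ (i + 2) * r ^ (i + 1) := by gcongr
      _ = (t * l n) * (t * r) ^ (i + 1) := by rw [mul_pow, pow_succ t (i + 1)]; ring
      _ ≤ _ := by
        gcongr
        · exact (hl.pos _).le
        · exact hl.ratio_mul_le hin hn
        · exact mul_ratio_le_ratio hxn (hx.pos _) ht1 (hx.ratio_mul_le hin hn)
  refine le_trans ?_ (Finset.sum_le_sum h1)
  have hs : HasSum (fun i : ℕ => l n * (1 - (i + 1) * (i + 2) / n) * r ^ (i + 1))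
      (l n * x n * (1 - 2 * (1 + x n) ^ 2 / n)) := by
    have h := ((hasSum_ratio_pow hxn).sub
      ((hasSum_choose_ratio_pow hxn).mul_left (1 / (n : ℝ)))).mul_left (l n)
    rw [show l n * (x n - 1 / n * (2 * x n * (1 + x n) ^ 2)) =
      l n * x n * (1 - 2 * (1 + x n) ^ 2 / n) by ring] at h
    refine h.congr_fun fun i => ?_
    rw [← hr]
    ring
  have h2 := hs.summable.sum_add_tsum_nat_add (n + 1)
  rw [hs.tsum_eq] at h2
  -- The terms beyond `n` are nonpositive, so the full series is a lower bound for the finite sum.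
  have h3 : ∑' i : ℕ, l n * (1 - (((i + (n + 1) : ℕ) : ℝ) + 1) * ((i + (n + 1) : ℕ) + 2) / n)
      * r ^ (i + (n + 1) + 1) ≤ 0 := by
    refine tsum_nonpos fun i => ?_
    have : (1 : ℝ) ≤ (((i + (n + 1) : ℕ) : ℝ) + 1) * ((i + (n + 1) : ℕ) + 2) / n := by
      rw [le_div_iff₀ hn']
      push_cast
      nlinarith [(Nat.cast_nonneg i : (0 : ℝ) ≤ i)]
    refine mul_nonpos_of_nonpos_of_nonneg (mul_nonpos_of_nonneg_of_nonpos hln.le (by linarith))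
      (by positivity)
  linarith

/-- For large `x n` the ratios are close to `1`, so each of the first `k` powers is at least `1 /
2`. -/
lemma card_mul_le_reachMean (hl : PosConcave l) (hx : PosConcave x) {n k : ℕ} (hkn : k ≤ n)
    (hk : 4 * k ^ 2 ≤ n) (hkx : 4 * k ≤ 1 + x n) : l 0 / 2 * k ≤ reachMean l x n := by
  rcases Nat.eq_zero_or_pos k with rfl | hk0
  · simp only [CharP.cast_eq_zero, mul_zero]
    exact Finset.sum_nonneg fun i _ => mul_nonneg (hl.pos _).le
      (pow_nonneg (div_nonneg (hx.pos _).le (by have := hx.pos (n - i); linarith)) _)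
  have hn : 0 < n := by omega
  have hn' : (0 : ℝ) < n := by exact_mod_cast hn
  have hxn := hx.pos n
  have hterm : ∀ i ∈ Finset.range k, l 0 / 2 ≤
      l (n - i) * (x (n - i) / (1 + x (n - i))) ^ (i + 1) := by
    intro i hi
    have hik : i + 1 ≤ k := Finset.mem_range.1 hi
    have hin : i ≤ n := by omega
    have hik' : (i : ℝ) + 1 ≤ k := by exact_mod_cast hik
    have hk' : 4 * (k : ℝ) ^ 2 ≤ n := by exact_mod_cast hk
    have hi0 : (0 : ℝ) ≤ i := by positivity
    set t : ℝ := i / n + 1 / (1 + x n) with ht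
    have h1 : (i + 1) * t ≤ 1 / 2 := by
      have e1 : ((i : ℝ) + 1) * (i / n) ≤ 1 / 4 := by
        rw [← mul_div_assoc, div_le_iff₀ hn']
        nlinarith
      have e2 : ((i : ℝ) + 1) * (1 / (1 + x n)) ≤ 1 / 4 := by
        rw [mul_one_div, div_le_iff₀ (by linarith)]
        linarith
      rw [ht, mul_add]
      linarith
    have hin' : (i : ℝ) / n ≤ 1 := by
      rw [div_le_one hn']; exact_mod_cast hin
    have ht0 : 0 ≤ t := by positivity
    have ht1 : t ≤ 1 / 2 := by nlinarith
    have h2 : 1 - t ≤ x (n - i) / (1 + x (n - i)) := by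
      refine le_trans ?_ (mul_ratio_le_ratio hxn (hx.pos _) (t := 1 - i / n)
        (by have : (0 : ℝ) ≤ i / n := by positivity
            linarith) (hx.ratio_mul_le hin hn))
      have e : x n / (1 + x n) = 1 - 1 / (1 + x n) := by field_simp; ring
      rw [e, ht]
      have : 0 ≤ (i / n : ℝ) * (1 / (1 + x n)) := by positivity
      linarith
    have h3 : (1 : ℝ) / 2 ≤ (1 - t) ^ (i + 1) := by
      have h := one_add_mul_le_pow (a := -t) (by linarith) (i + 1)
      rw [← sub_eq_add_neg] at h
      refine le_trans ?_ h
      push_cast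
      linarith
    calc l 0 / 2 = l 0 * (1 / 2) := by ring
      _ ≤ l (n - i) * (x (n - i) / (1 + x (n - i))) ^ (i + 1) := by
        gcongr
        · exact (hl.pos _).le
        · exact hl.monotone (Nat.zero_le _)
        · exact h3.trans (pow_le_pow_left₀ (by linarith) h2 _)
  calc l 0 / 2 * k = ∑ i ∈ Finset.range k, l 0 / 2 := by simp [mul_comm]
    _ ≤ ∑ i ∈ Finset.range k, l (n - i) * (x (n - i) / (1 + x (n - i))) ^ (i + 1) :=
      Finset.sum_le_sum hterm
    _ ≤ reachMean l x n := by
      refine Finset.sum_le_sum_of_subset_of_nonneg ?_ fun i _ _ => mul_nonneg (hl.pos _).le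
        (pow_nonneg (div_nonneg (hx.pos _).le (by have := hx.pos (n - i); linarith)) _)
      exact Finset.range_subset_range.2 (by omega)

/-- From `exp y ≥ y ^ 8 / 8!`: the eighth power turns the fourth root of `n` into `n ^ 2`. -/
lemma summable_exp_neg_mul_sqrt_sqrt {c : ℝ} (hc : 0 < c) :
    Summable fun n : ℕ => Real.exp (-(c * √√(n : ℝ))) := by
  refine Summable.of_norm_bounded_eventually_nat
    (g := fun n : ℕ => (Nat.factorial 8 / c ^ 8 : ℝ) * (1 / (n : ℝ) ^ 2))
    ((Real.summable_one_div_nat_pow.2 one_lt_two).mul_left _) ?_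
  filter_upwards [Filter.eventually_gt_atTop 0] with n hn
  have hn' : (0 : ℝ) < n := by exact_mod_cast hn
  have hs : 0 < √√(n : ℝ) := by positivity
  have h4 : √√(n : ℝ) ^ 8 = (n : ℝ) ^ 2 := by
    rw [show 8 = 2 * (2 * 2) from rfl, pow_mul, Real.sq_sqrt (by positivity), pow_mul,
      Real.sq_sqrt hn'.le]
  have h := Real.pow_div_factorial_le_exp (c * √√(n : ℝ)) (by positivity) 8
  rw [Real.norm_of_nonneg (Real.exp_pos _).le, Real.exp_neg, ← h4]
  rw [inv_le_comm₀ (Real.exp_pos _) (by positivity)]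
  refine le_trans (le_of_eq ?_) h
  field_simp

lemma summable_exp_neg_reachMean (hl : PosConcave l) (hx : PosConcave x)
    (h : Summable fun n => Real.exp (-(l n * x n))) :
    Summable fun n => Real.exp (-reachMean l x n) := by
  have hl0 := hl.pos 0
  refine Summable.of_norm_bounded_eventually_nat
    -- One summand for each case below, with `s = n ^ (1 / 4)`: `1 + x n ≤ s` and `l n * x n ≤ s ^
    -- 2`, where the error is at most `2`; `1 + x n ≤ s` and `l n * x n > s ^ 2`; and `1 + x n > s`,
    -- where about `s / 4` terms of size `l 0 / 2` are counted.
    (g := fun n : ℕ => Real.exp 2 * Real.exp (-(l n * x n)) +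
      (Real.exp (-(1 / 2 * √√(n : ℝ))) + Real.exp (l 0 / 2) * Real.exp (-(l 0 / 8 * √√(n : ℝ)))))
    ((h.mul_left _).add ((summable_exp_neg_mul_sqrt_sqrt (by norm_num)).add
      ((summable_exp_neg_mul_sqrt_sqrt (by positivity)).mul_left _))) ?_
  filter_upwards [Filter.eventually_ge_atTop 16] with n hn
  have hn' : (16 : ℝ) ≤ n := by exact_mod_cast hn
  have hln := hl.pos n
  have hxn := hx.pos n
  rw [Real.norm_of_nonneg (Real.exp_pos _).le]
  set s := √√(n : ℝ) with hs
  have hs2 : s ^ 2 = √(n : ℝ) := Real.sq_sqrt (by positivity)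
  have hs4 : s ^ 4 = n := by
    rw [show 4 = 2 * 2 from rfl, pow_mul, hs2, Real.sq_sqrt (by positivity)]
  have hs0 : 0 ≤ s := by positivity
  have hs24 : 4 ≤ s ^ 2 := by
    by_contra! hlt
    nlinarith
  have hs2' : 2 ≤ s := by nlinarith
  rw [← Real.exp_add, ← Real.exp_add]
  rcases le_or_gt (1 + x n) s with hc | hc
  · have hlow := mul_one_sub_le_reachMean hl hx (n := n) (by omega)
    have hb : 2 * (1 + x n) ^ 2 / n ≤ 2 / s ^ 2 := by
      rw [div_le_div_iff₀ (by linarith) (by positivity), ← hs4]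
      have : (1 + x n) ^ 2 ≤ s ^ 2 := by gcongr
      nlinarith [sq_nonneg s]
    have hlow' : l n * x n * (1 - 2 / s ^ 2) ≤ reachMean l x n :=
      le_trans (by gcongr) hlow
    rcases le_or_gt (l n * x n) (s ^ 2) with hF | hF
    · have h1 : l n * x n - 2 ≤ reachMean l x n := by
        refine le_trans ?_ hlow'
        have : l n * x n * (2 / s ^ 2) ≤ 2 := by
          rw [← mul_div_assoc, div_le_iff₀ (by positivity)]
          linarith
        linarith
      have h2 : Real.exp (-reachMean l x n) ≤ Real.exp (2 + -(l n * x n)) :=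
        Real.exp_le_exp.2 (by linarith)
      have := Real.exp_pos (-(1 / 2 * s))
      have := Real.exp_pos (l 0 / 2 + -(l 0 / 8 * s))
      linarith
    · have h1 : 1 / 2 * s ≤ reachMean l x n := by
        refine le_trans ?_ hlow'
        have h3 : 2 / s ^ 2 ≤ 1 / 2 := by
          rw [div_le_iff₀ (by positivity)]
          linarith
        have h4 : s ^ 2 * (1 / 2) ≤ l n * x n * (1 - 2 / s ^ 2) := by
          gcongr
          linarith
        nlinarith
      have h2 : Real.exp (-reachMean l x n) ≤ Real.exp (-(1 / 2 * s)) :=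
        Real.exp_le_exp.2 (by linarith)
      have := Real.exp_pos (2 + -(l n * x n))
      have := Real.exp_pos (l 0 / 2 + -(l 0 / 8 * s))
      linarith
  · have hk1 : (⌊s / 4⌋₊ : ℝ) ≤ s / 4 := Nat.floor_le (by positivity)
    have hk2 : s / 4 < ⌊s / 4⌋₊ + 1 := Nat.lt_floor_add_one _
    have hk0 : (0 : ℝ) ≤ ⌊s / 4⌋₊ := by positivity
    have hkn : 4 * ((⌊s / 4⌋₊ : ℕ) : ℝ) ^ 2 ≤ n := by
      have : ((⌊s / 4⌋₊ : ℕ) : ℝ) ^ 2 ≤ (s / 4) ^ 2 := by gcongr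
      nlinarith
    have hkn' : 4 * ⌊s / 4⌋₊ ^ 2 ≤ n := by exact_mod_cast hkn
    have hlow := card_mul_le_reachMean hl hx (n := n) (k := ⌊s / 4⌋₊) (by nlinarith) hkn'
      (by linarith)
    have h1 : l 0 / 8 * s - l 0 / 2 ≤ reachMean l x n := by
      refine le_trans ?_ hlow
      nlinarith
    have h2 : Real.exp (-reachMean l x n) ≤ Real.exp (l 0 / 2 + -(l 0 / 8 * s)) :=
      Real.exp_le_exp.2 (by linarith)
    have := Real.exp_pos (2 + -(l n * x n))
    have := Real.exp_pos (-(1 / 2 * s))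
    linarith

lemma summable_exp_neg_reachMean_iff (hl : PosConcave l) (hx : PosConcave x) :
    (Summable fun n => Real.exp (-reachMean l x n)) ↔
      Summable fun n => Real.exp (-(l n * x n)) := by
  refine ⟨fun h => ?_, summable_exp_neg_reachMean hl hx⟩
  exact h.of_nonneg_of_le (fun n => (Real.exp_pos _).le)
    fun n => Real.exp_le_exp.2 (neg_le_neg (reachMean_le hl hx n))

end ConcaveSequences

/-! ### Independence, stochastic domination and uniqueness for product measures. -/

section ProductMeasure

lemma indepFun_restrict_infinitePi {ι : Type*} {X : ι → Type*} {mX : ∀ i, MeasurableSpace (X i)}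
    (μ : ∀ i, Measure (X i)) [∀ i, IsProbabilityMeasure (μ i)] {S T : Set ι} (hST : Disjoint S T) :
    IndepFun (fun (x : ∀ i, X i) (i : S) => x i) (fun (x : ∀ i, X i) (i : T) => x i)
      (Measure.infinitePi μ) := by
  have h := (iIndepFun_infinitePi (P := μ) (X := fun i (y : X i) => y)
    (fun i => measurable_id)).iIndep
  have h2 := indep_iSup_of_disjoint (fun i => (measurable_pi_apply i).comap_le) h hST
  have key : ∀ U : Set ι, MeasurableSpace.comap (fun (x : ∀ i, X i) (i : U) => x i)
      MeasurableSpace.pi = ⨆ i ∈ U, MeasurableSpace.comap (fun x : ∀ i, X i => x i) (mX i) := by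
    intro U
    simp only [MeasurableSpace.pi, MeasurableSpace.comap_iSup, MeasurableSpace.comap_comp]
    rw [iSup_subtype]
    rfl
  rw [IndepFun_iff_Indep, key, key]
  exact h2

/-- A quantile function of a probability measure on `ℕ`. -/
noncomputable def quantile (ρ : Measure ℕ) (u : unitInterval) : ℕ :=
  sInf {k | ENNReal.ofReal u ≤ ρ (Set.Iic k)}

/-- The condition `u < 1` makes the set in `quantile` nonempty; otherwise `sInf` could take its
default value `0`. -/
lemma quantile_le_iff (ρ : Measure ℕ) [IsProbabilityMeasure ρ] {u : unitInterval} (hu : u < 1)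
    (k : ℕ) : quantile ρ u ≤ k ↔ ENNReal.ofReal u ≤ ρ (Set.Iic k) := by
  have hne : {k | ENNReal.ofReal u ≤ ρ (Set.Iic k)}.Nonempty := by
    have ht : Filter.Tendsto (fun k : ℕ => ρ (Set.Iic k)) Filter.atTop (nhds 1) := by
      simpa using tendsto_measure_Iic_atTop ρ
    have hlt : ENNReal.ofReal u < 1 := by
      rw [ENNReal.ofReal_lt_one]
      exact hu
    exact ((ht.eventually_const_lt hlt).exists).imp fun k hk => hk.le
  refine ⟨fun h => ?_, fun h => Nat.sInf_le h⟩
  have h1 : ENNReal.ofReal u ≤ ρ (Set.Iic (quantile ρ u)) := Nat.sInf_mem hne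
  exact h1.trans (measure_mono (Set.Iic_subset_Iic.2 h))

lemma ae_lt_one : ∀ᵐ u : unitInterval, u < 1 := by
  filter_upwards [compl_mem_ae_iff.2 (measure_singleton (μ := (volume : Measure unitInterval)) 1)]
    with u hu
  exact lt_of_le_of_ne unitInterval.le_one' hu

lemma measurable_sInf_setOf_mem {Ω : Type*} [MeasurableSpace Ω] {P : ℕ → Set Ω}
    (hP : ∀ k, MeasurableSet (P k)) : Measurable fun ω => sInf {k | ω ∈ P k} := by
  refine measurable_to_countable' fun k => ?_
  -- The second piece is the empty set of indices, for which `sInf` is `0`.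
  have : (fun ω => sInf {k | ω ∈ P k}) ⁻¹' {k} =
      (P k ∩ ⋂ i ∈ Set.Iio k, (P i)ᶜ) ∪ ({ω | k = 0} ∩ ⋂ i, (P i)ᶜ) := by
    ext ω
    simp only [Set.mem_preimage, Set.mem_singleton_iff, Set.mem_union, Set.mem_inter_iff,
      Set.mem_ofPred_eq, Set.mem_iInter, Set.mem_compl_iff, Set.mem_Iio]
    constructor
    · rintro rfl
      by_cases hne : {k | ω ∈ P k}.Nonempty
      · exact Or.inl ⟨Nat.sInf_mem hne, fun i hi => Nat.notMem_of_lt_sInf hi⟩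
      · rw [Set.not_nonempty_iff_eq_empty] at hne
        exact Or.inr ⟨by rw [hne, Nat.sInf_empty], Set.eq_empty_iff_forall_notMem.1 hne⟩
    · rintro (⟨h1, h2⟩ | ⟨rfl, h2⟩)
      · exact le_antisymm (Nat.sInf_le h1) (le_csInf ⟨k, h1⟩ fun i hi => by
          by_contra! hlt
          exact h2 i hlt hi)
      · have : {k | ω ∈ P k} = ∅ := Set.eq_empty_iff_forall_notMem.2 h2
        rw [this, Nat.sInf_empty]
  rw [this]
  exact ((hP k).inter (MeasurableSet.biInter (Set.to_countable _) fun i _ => (hP i).compl)).union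
    (MeasurableSet.inter (by simp) (MeasurableSet.iInter fun i => (hP i).compl))

lemma measurable_quantile (ρ : Measure ℕ) : Measurable (quantile ρ) :=
  measurable_sInf_setOf_mem (P := fun k => {u : unitInterval | ENNReal.ofReal u ≤ ρ (Set.Iic k)})
    fun _ => measurableSet_le (by fun_prop) measurable_const

lemma map_quantile (ρ : Measure ℕ) [IsProbabilityMeasure ρ] :
    (volume : Measure unitInterval).map (quantile ρ) = ρ := by
  have := Measure.isProbabilityMeasure_map (μ := (volume : Measure unitInterval))
    (measurable_quantile ρ).aemeasurable
  refine Measure.ext_of_Iic _ _ fun k => ?_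
  rw [Measure.map_apply (measurable_quantile ρ) measurableSet_Iic]
  have hle : ρ.real (Set.Iic k) ≤ 1 := measureReal_le_one
  have h1 : quantile ρ ⁻¹' Set.Iic k =ᵐ[volume]
      Set.Iic (⟨ρ.real (Set.Iic k), measureReal_nonneg, hle⟩ : unitInterval) := by
    filter_upwards [ae_lt_one] with u hu
    refine propext ?_
    show quantile ρ u ≤ k ↔ (u : ℝ) ≤ ρ.real (Set.Iic k)
    rw [quantile_le_iff ρ hu, ENNReal.ofReal_le_iff_le_toReal (measure_ne_top _ _)]
    rfl
  rw [measure_congr h1, unitInterval.volume_Iic]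
  exact ofReal_measureReal

/-- Stochastic domination: increasing events have a larger probability under a product measure
with stochastically larger factors. -/
lemma infinitePi_le_infinitePi_of_Iic_le (ρ ρ' : ℕ → Measure ℕ) [∀ i, IsProbabilityMeasure (ρ i)]
    [∀ i, IsProbabilityMeasure (ρ' i)] (h : ∀ i k, ρ' i (Set.Iic k) ≤ ρ i (Set.Iic k))
    {A : Set (ℕ → ℕ)} (hA : MeasurableSet A) (hup : IsUpperSet A) :
    Measure.infinitePi ρ A ≤ Measure.infinitePi ρ' A := by
  -- Coupling: both product measures are images of the same independent uniform variables under
  -- quantile functions, which are ordered almost everywhere.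
  have e : ∀ σ : ℕ → Measure ℕ, (∀ i, IsProbabilityMeasure (σ i)) →
      Measure.infinitePi σ A =
        Measure.infinitePi (fun _ : ℕ => (volume : Measure unitInterval))
          ((fun v i => quantile (σ i) (v i)) ⁻¹' A) := by
    intro σ _
    have hm := Measure.infinitePi_map_pi (fun _ : ℕ => (volume : Measure unitInterval))
      (f := fun i => quantile (σ i)) (fun i => measurable_quantile (σ i))
    simp only [map_quantile] at hm
    rw [← hm, Measure.map_apply _ hA]
    exact measurable_pi_lambda _ fun i => (measurable_quantile _).comp (measurable_pi_apply i)
  rw [e ρ inferInstance, e ρ' inferInstance]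
  refine measure_mono_ae ?_
  have hae : ∀ᵐ v : ℕ → unitInterval ∂(Measure.infinitePi
      (fun _ : ℕ => (volume : Measure unitInterval))), ∀ i, v i < 1 := by
    rw [ae_all_iff]
    exact fun i => (measurePreserving_eval_infinitePi
      (fun _ : ℕ => (volume : Measure unitInterval)) i).quasiMeasurePreserving.ae ae_lt_one
  filter_upwards [hae] with v hv hvA
  refine hup (fun i => ?_) hvA
  rw [quantile_le_iff _ (hv i)]
  exact ((quantile_le_iff _ (hv i) _).1 le_rfl).trans (h i _)

/-- A probability measure on sequences of natural numbers is a product measure if it is one on the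
events that finitely many coordinates are bounded. -/
lemma eq_infinitePi_of_forall_le (ρ : ℕ → Measure ℕ) [∀ i, IsProbabilityMeasure (ρ i)]
    {Q : Measure (ℕ → ℕ)}
    (h : ∀ (J : Finset ℕ) (k : ℕ → ℕ), Q {x | ∀ j ∈ J, x j ≤ k j} = ∏ j ∈ J, ρ j (Set.Iic (k j))) :
    Q = Measure.infinitePi ρ := by
  refine ((Measure.isProjectiveLimit_infinitePi ρ).unique fun I => ?_).symm
  symm
  refine Measure.pi_eq_generateFrom (C := fun _ => Set.range Set.Iic) (fun i => ?_)
    (fun i => isPiSystem_Iic) (fun i => ⟨fun n => Set.Iic n, fun n => ⟨n, rfl⟩,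
      fun n => measure_lt_top _ _, Set.iUnion_Iic⟩) fun s hs => ?_
  · rw [← borel_eq_generateFrom_Iic]
    exact (BorelSpace.measurable_eq (α := ℕ)).symm
  · choose k hk using hs
    rw [Measure.map_apply (by fun_prop) (MeasurableSet.univ_pi fun i => MeasurableSet.of_discrete)]
    have h1 := h I (fun j => if hj : j ∈ I then k ⟨j, hj⟩ else 0)
    have e : I.restrict ⁻¹' Set.univ.pi s =
        {x : ℕ → ℕ | ∀ j ∈ I, x j ≤ if hj : j ∈ I then k ⟨j, hj⟩ else 0} := by
      ext x
      simp only [← hk, Set.mem_preimage, Set.mem_pi, Set.mem_univ, true_implies, Set.mem_Iic,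
        Set.mem_ofPred_eq, Subtype.forall, Finset.restrict]
      refine forall_congr' fun j => forall_congr' fun hj => ?_
      rw [dif_pos hj]
    rw [e, h1, ← Finset.prod_attach]
    refine Finset.prod_congr rfl fun j _ => ?_
    rw [← hk, dif_pos j.2]

end ProductMeasure

/-! ### Barriers for independent ranges. -/

section Barrier

lemma tsum_nat_add_eq_top {f : ℕ → ENNReal} (hf : ∀ i, f i ≠ ⊤) (h : ∑' i, f i = ⊤) (k : ℕ) :
    ∑' i, f (i + k) = ⊤ := by
  by_contra hfin
  have h1 := (ENNReal.summable (f := fun i => f (i + k))).sum_add_tsum_nat_add'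
  rw [h] at h1
  exact ENNReal.add_ne_top.2 ⟨(ENNReal.sum_lt_top.2 fun i _ => (hf i).lt_top).ne, hfin⟩ h1

/-- No jump from a site in `[K, m]` passes `m`, where `x j` is the range of the site `j`. -/
def barrier (K m : ℕ) : Set (ℕ → ℕ) := {x | ∀ j, K ≤ j → j ≤ m → x j + j ≤ m}

lemma measurableSet_barrier (K m : ℕ) : MeasurableSet (barrier K m) := by
  have : barrier K m = ⋂ j, ⋂ (_ : K ≤ j), ⋂ (_ : j ≤ m), {x : ℕ → ℕ | x j + j ≤ m} := by
    ext x; simp [barrier]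
  rw [this]
  exact MeasurableSet.iInter fun j => MeasurableSet.iInter fun _ => MeasurableSet.iInter fun _ =>
    measurableSet_le (by fun_prop) measurable_const

/-- None of the sites from `K` on is a barrier for the jumps that start at `K` or to its right. -/
def noBarrier (K : ℕ) : Set (ℕ → ℕ) := {x | ∀ m, K ≤ m → x ∉ barrier K m}

lemma measurableSet_noBarrier (K : ℕ) : MeasurableSet (noBarrier K) := by
  have : noBarrier K = ⋂ m, ⋂ (_ : K ≤ m), (barrier K m)ᶜ := by
    ext x; simp [noBarrier]
  rw [this]
  exact MeasurableSet.iInter fun m => MeasurableSet.iInter fun _ => (measurableSet_barrier K m).compl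

lemma isUpperSet_noBarrier (K : ℕ) : IsUpperSet (noBarrier K) := by
  intro x y hxy hx m hm hy
  exact hx m hm fun j h1 h2 => (Nat.add_le_add_right (hxy j) j).trans (hy j h1 h2)

lemma barrier_anti {K L : ℕ} (h : K ≤ L) (m : ℕ) : barrier K m ⊆ barrier L m :=
  fun _ hx j hj => hx j (h.trans hj)

variable (ρ : ℕ → Measure ℕ) [∀ i, IsProbabilityMeasure (ρ i)]

lemma infinitePi_barrier (K m : ℕ) :
    Measure.infinitePi ρ (barrier K m) = ∏ j ∈ Finset.Icc K m, ρ j (Set.Iic (m - j)) := by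
  rw [← Measure.infinitePi_pi ρ (fun _ _ => measurableSet_Iic)]
  congr 1
  ext x
  simp only [barrier, Set.mem_ofPred_eq, Set.mem_pi, Finset.coe_Icc, Set.mem_Icc, Set.mem_Iic]
  exact ⟨fun h j hj => by have := h j hj.1 hj.2; omega,
    fun h j h1 h2 => by have := h j ⟨h1, h2⟩; omega⟩

lemma infinitePi_barrier_inter_noBarrier (K m : ℕ) :
    Measure.infinitePi ρ (barrier K m ∩ noBarrier (m + 1)) =
      Measure.infinitePi ρ (barrier K m) * Measure.infinitePi ρ (noBarrier (m + 1)) := by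
  have hd : Disjoint (Set.Iic m) (Set.Ici (m + 1)) := by
    rw [Set.disjoint_left]
    intro a h1 h2
    simp only [Set.mem_Iic, Set.mem_Ici] at h1 h2
    omega
  set A : Set (Set.Iic m → ℕ) := {y | ∀ j : Set.Iic m, K ≤ j → y j + j ≤ m} with hA
  set B : Set (Set.Ici (m + 1) → ℕ) :=
    ⋂ n, ⋂ (_ : m + 1 ≤ n), (⋂ j : Set.Ici (m + 1), ⋂ (_ : (j : ℕ) ≤ n),
      {y : Set.Ici (m + 1) → ℕ | y j + j ≤ n})ᶜ with hB
  have hmA : MeasurableSet A := by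
    rw [hA]
    simp only [Set.ofPred_forall]
    exact MeasurableSet.iInter fun j => MeasurableSet.iInter fun _ =>
      measurableSet_le (by fun_prop) measurable_const
  have hmB : MeasurableSet B :=
    MeasurableSet.iInter fun n => MeasurableSet.iInter fun _ => MeasurableSet.compl <|
      MeasurableSet.iInter fun j => MeasurableSet.iInter fun _ =>
        measurableSet_le (by fun_prop) measurable_const
  have h := (indepFun_restrict_infinitePi ρ hd).measure_inter_preimage_eq_mul A B hmA hmB
  have e1 : (fun (x : ℕ → ℕ) (i : Set.Iic m) => x i) ⁻¹' A = barrier K m := by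
    ext x
    simp only [hA, Set.mem_preimage, Set.mem_ofPred_eq, barrier, Subtype.forall, Set.mem_Iic]
    exact forall_congr' fun a => ⟨fun h h1 h2 => h h2 h1, fun h h1 h2 => h h2 h1⟩
  have e2 : (fun (x : ℕ → ℕ) (i : Set.Ici (m + 1)) => x i) ⁻¹' B = noBarrier (m + 1) := by
    ext x
    simp only [hB, noBarrier, barrier, Set.mem_preimage, Set.mem_iInter, Set.mem_compl_iff,
      Set.mem_ofPred_eq, Subtype.forall, Set.mem_Ici]
  rwa [e1, e2] at h

/-- If the ranges of the sites are stochastically increasing and the expected number of barriers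
is infinite, then there is almost surely a barrier to the right of every site. -/
lemma infinitePi_noBarrier_eq_zero (hmono : ∀ i k, ρ (i + 1) (Set.Iic k) ≤ ρ i (Set.Iic k))
    (hsum : ∑' m, Measure.infinitePi ρ (barrier 0 m) = ⊤) (K : ℕ) :
    Measure.infinitePi ρ (noBarrier K) = 0 := by
  have hmono' : ∀ d i k, ρ (i + d) (Set.Iic k) ≤ ρ i (Set.Iic k) := by
    intro d
    induction d with
    | zero => exact fun i k => le_rfl
    | succ d ih => exact fun i k => (hmono (i + d) k).trans (ih i k)
  -- Shifting the starting site makes the ranges stochastically larger, and the absence of barriers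
  -- is an increasing event.
  have hshift : ∀ d, Measure.infinitePi ρ (noBarrier K) ≤
      Measure.infinitePi ρ (noBarrier (K + d)) := by
    intro d
    have hm := Measure.map_infinitePi_infinitePi_of_inj (P := ρ) (add_left_injective d)
    have hpre : (fun (x : ℕ → ℕ) i => x (i + d)) ⁻¹' noBarrier K = noBarrier (K + d) := by
      ext x
      simp only [noBarrier, barrier, Set.mem_preimage, Set.mem_ofPred_eq]
      constructor
      · intro h m hm hb
        refine h (m - d) (by omega) fun j h1 h2 => ?_
        have := hb (j + d) (by omega) (by omega)
        omega
      · intro h m hm hb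
        refine h (m + d) (by omega) fun j h1 h2 => ?_
        have := hb (j - d) (by omega) (by omega)
        rw [Nat.sub_add_cancel (by omega)] at this
        omega
    rw [← hpre, ← Measure.map_apply (by fun_prop) (measurableSet_noBarrier K), hm]
    exact infinitePi_le_infinitePi_of_Iic_le _ _ (hmono' d) (measurableSet_noBarrier K)
      (isUpperSet_noBarrier K)
  by_contra hne
  -- The `i`-th event says that `K + i` is the last barrier: a later barrier for `K` would also be
  -- one for `K + i + 1`.
  have hdisj : Pairwise (Function.onFun Disjoint fun i : ℕ =>
      barrier K (K + i) ∩ noBarrier (K + i + 1)) := by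
    have key : ∀ i j : ℕ, i < j → Disjoint (barrier K (K + i) ∩ noBarrier (K + i + 1))
        (barrier K (K + j) ∩ noBarrier (K + j + 1)) := by
      intro i j hij
      rw [Set.disjoint_left]
      rintro x ⟨-, h1⟩ ⟨h2, -⟩
      exact h1 (K + j) (by omega) (barrier_anti (by omega) _ h2)
    intro i j hij
    rcases lt_or_gt_of_ne hij with h | h
    · exact key i j h
    · exact (key j i h).symm
  have h1 : ∑' i, Measure.infinitePi ρ (barrier K (K + i) ∩ noBarrier (K + i + 1)) ≤ 1 := by
    rw [← measure_iUnion hdisj fun i =>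
      (measurableSet_barrier _ _).inter (measurableSet_noBarrier _)]
    exact prob_le_one
  have h2 : ∑' i, Measure.infinitePi ρ (barrier K (K + i)) = ⊤ := by
    have h3 : ∑' i, Measure.infinitePi ρ (barrier 0 (i + K)) = ⊤ :=
      tsum_nat_add_eq_top (fun i => measure_ne_top _ _) hsum K
    refine top_unique (h3.symm.le.trans (ENNReal.tsum_le_tsum fun i => measure_mono ?_))
    rw [add_comm]
    exact barrier_anti (Nat.zero_le _) _
  -- Independence of the sites up to `K + i` and beyond splits each event; then `hshift` removes the
  -- dependence on `i`. An infinite sum times a nonzero constant would be at most `1`.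
  have h3 : ∑' i, Measure.infinitePi ρ (barrier K (K + i)) * Measure.infinitePi ρ (noBarrier K) ≤
      ∑' i, Measure.infinitePi ρ (barrier K (K + i) ∩ noBarrier (K + i + 1)) := by
    refine ENNReal.tsum_le_tsum fun i => ?_
    rw [infinitePi_barrier_inter_noBarrier]
    exact mul_le_mul' le_rfl (hshift (i + 1))
  rw [ENNReal.tsum_mul_right, h2, ENNReal.top_mul hne] at h3
  exact absurd (h3.trans h1) (by simp)

/-- Barriers concatenate: one at `m` for the start `K`, followed by one at `n > m` for the sites
beyond `m`, makes `n` a barrier for `K`. -/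
lemma exists_barrier_of_forall_notMem_noBarrier {K : ℕ} {x : ℕ → ℕ}
    (h : ∀ L, K ≤ L → x ∉ noBarrier L) (N : ℕ) : ∃ m, N ≤ m ∧ x ∈ barrier K m := by
  have hL : ∀ L, K ≤ L → ∃ m, L ≤ m ∧ x ∈ barrier L m := by
    intro L hKL
    have := h L hKL
    simp only [noBarrier, Set.mem_ofPred_eq] at this
    push Not at this
    exact this
  induction N with
  | zero =>
    obtain ⟨m, -, hm⟩ := hL K le_rfl
    exact ⟨m, Nat.zero_le _, hm⟩
  | succ N ih =>
    obtain ⟨m, hNm, hm⟩ := ih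
    obtain ⟨n, hmn, hn⟩ := hL (max K (m + 1)) (le_max_left _ _)
    refine ⟨n, by omega, fun j h1 h2 => ?_⟩
    rcases le_or_gt j m with hj | hj
    · have := hm j h1 hj
      omega
    · exact hn j (by omega) h2

/-- With an arbitrary range at the origin and stochastically increasing ranges at the other sites,
there is almost surely a barrier if the expected number of barriers for the jumps
from these other sites is infinite. -/
lemma ae_exists_barrier (hmono : ∀ i k, ρ (i + 2) (Set.Iic k) ≤ ρ (i + 1) (Set.Iic k))
    (hsum : ∑' m, Measure.infinitePi ρ (barrier 1 (m + 1)) = ⊤) :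
    ∀ᵐ x ∂Measure.infinitePi ρ, ∃ m, x ∈ barrier 0 m := by
  have hm := Measure.map_infinitePi_infinitePi_of_inj (P := ρ) (add_left_injective 1)
  have hpre : ∀ m, (fun (x : ℕ → ℕ) i => x (i + 1)) ⁻¹' barrier 0 m = barrier 1 (m + 1) := by
    intro m
    ext x
    simp only [barrier, Set.mem_preimage, Set.mem_ofPred_eq]
    constructor
    · intro h j h1 h2
      have := h (j - 1) (by omega) (by omega)
      rw [Nat.sub_add_cancel h1] at this
      omega
    · intro h j h1 h2
      have := h (j + 1) (by omega) (by omega)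
      omega
  have hz : ∀ K, Measure.infinitePi (fun i => ρ (i + 1)) (noBarrier K) = 0 := by
    refine infinitePi_noBarrier_eq_zero _ (fun i k => hmono i k) ?_
    rw [← hsum]
    refine tsum_congr fun m => ?_
    rw [← hpre, ← hm, Measure.map_apply (by fun_prop) (measurableSet_barrier 0 m)]
  have hae : ∀ᵐ y ∂Measure.infinitePi (fun i => ρ (i + 1)), ∀ K, y ∉ noBarrier K :=
    ae_all_iff.2 fun K => measure_eq_zero_iff_ae_notMem.1 (hz K)
  rw [← hm] at hae
  filter_upwards [ae_of_ae_map (Measurable.aemeasurable (by fun_prop)) hae] with x hx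
  -- A barrier beyond `x 0` also stops the jump from the origin.
  obtain ⟨m, h1, h2⟩ := exists_barrier_of_forall_notMem_noBarrier (K := 0) (fun L _ => hx L) (x 0)
  have h3 : x ∈ barrier 1 (m + 1) := by
    rw [← hpre]
    exact h2
  refine ⟨m + 1, fun j _ hj => ?_⟩
  rcases Nat.eq_zero_or_pos j with rfl | hj0
  · omega
  · exact h3 j hj0 hj

/-- If the expected number of barriers for the jumps from the sites `j ≥ 1` is finite, and the range
at the origin is unbounded, then there is no barrier with positive probability. -/
lemma infinitePi_noBarrier_zero_pos (hsum : ∑' m, Measure.infinitePi ρ (barrier 1 (m + 1)) ≠ ⊤)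
    (h0 : ∀ N, ρ 0 (Set.Ici N) ≠ 0) :
    Measure.infinitePi ρ (noBarrier 0) ≠ 0 := by
  -- A tail of total mass below `1` leaves positive probability for no barrier beyond `N`.
  obtain ⟨N, hN⟩ := ((ENNReal.tendsto_sum_nat_add _ hsum).eventually_lt_const one_pos).exists
  set B : Set (ℕ → ℕ) := ⋃ k, barrier 1 (k + N + 1) with hB
  have hBlt : Measure.infinitePi ρ B < 1 := (measure_iUnion_le _).trans_lt hN
  have hBm : MeasurableSet B := MeasurableSet.iUnion fun k => measurableSet_barrier _ _
  have hBc : Measure.infinitePi ρ Bᶜ ≠ 0 := by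
    rw [prob_compl_eq_one_sub hBm]
    exact (tsub_pos_of_lt hBlt).ne'
  have hd : Disjoint ({0} : Set ℕ) (Set.Ici 1) := by simp
  set A' : Set (({0} : Set ℕ) → ℕ) := {y | N + 1 ≤ y ⟨0, rfl⟩} with hA'
  set B' : Set (Set.Ici 1 → ℕ) :=
    ⋂ k, (⋂ j : Set.Ici 1, ⋂ (_ : (j : ℕ) ≤ k + N + 1),
      {y : Set.Ici 1 → ℕ | y j + (j : ℕ) ≤ k + N + 1})ᶜ with hB'
  have hmA : MeasurableSet A' := measurableSet_le measurable_const (by fun_prop)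
  have hmB : MeasurableSet B' :=
    MeasurableSet.iInter fun n => MeasurableSet.compl <|
      MeasurableSet.iInter fun j => MeasurableSet.iInter fun _ =>
        measurableSet_le (by fun_prop) measurable_const
  have h := (indepFun_restrict_infinitePi ρ hd).measure_inter_preimage_eq_mul A' B' hmA hmB
  have e1 : (fun (x : ℕ → ℕ) (i : ({0} : Set ℕ)) => x i) ⁻¹' A' =
      (fun x => x 0) ⁻¹' (Set.Ici (N + 1)) := rfl
  have e2 : (fun (x : ℕ → ℕ) (i : Set.Ici 1) => x i) ⁻¹' B' = Bᶜ := by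
    ext x
    simp only [hB', hB, barrier, Set.mem_preimage, Set.mem_iInter, Set.mem_compl_iff,
      Set.mem_iUnion, not_exists, Set.mem_ofPred_eq, Subtype.forall, Set.mem_Ici]
  have h1 : Measure.infinitePi ρ ((fun x => x 0) ⁻¹' (Set.Ici (N + 1))) = ρ 0 (Set.Ici (N + 1)) :=
    (measurePreserving_eval_infinitePi ρ 0).measure_preimage measurableSet_Ici.nullMeasurableSet
  rw [e1, e2, h1] at h
  refine (lt_of_lt_of_le (h ▸ pos_iff_ne_zero.2 (mul_ne_zero (h0 _) hBc)) (measure_mono ?_)).ne'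
  rintro x ⟨hx0, hxB⟩ m - hb
  have hx0' : N + 1 ≤ x 0 := hx0
  have := hb 0 le_rfl (Nat.zero_le _)
  -- The range `x 0 ≥ N + 1` of the origin has excluded every `m ≤ N`.
  refine hxB (Set.mem_iUnion.2 ⟨m - (N + 1), ?_⟩)
  rw [show m - (N + 1) + N + 1 = m by omega]
  exact barrier_anti (Nat.zero_le _) _ hb

end Barrier

/-! ### The maximum of a single walk with drift to the left. -/

section Walk

/-- The law of the steps of a frog that steps to the left with probability `q`. -/
noncomputable def walkLaw (q : unitInterval) : Measure (ℕ → ℤ) :=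
  Measure.infinitePi fun _ => bernoulliMeasure (-1 : ℤ) 1 q

instance (q : unitInterval) : IsProbabilityMeasure (walkLaw q) := by
  unfold walkLaw; infer_instance

/-- The walk with the given steps, started at `0`, is at `k` or to its right at some time. -/
def reach (k : ℕ) : Set (ℕ → ℤ) := {w | ∃ n, (k : ℤ) ≤ ∑ s ∈ Finset.range n, w s}

lemma measurableSet_reach (k : ℕ) : MeasurableSet (reach k) := by
  have : reach k = ⋃ n, {w : ℕ → ℤ | (k : ℤ) ≤ ∑ s ∈ Finset.range n, w s} := by
    ext w; simp [reach]
  rw [this]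
  exact MeasurableSet.iUnion fun n => measurableSet_le measurable_const (by fun_prop)

lemma reach_zero : reach 0 = Set.univ := Set.eq_univ_of_forall fun _ => ⟨0, by simp⟩

lemma reach_antitone : Antitone reach :=
  fun _ _ h _ ⟨n, hn⟩ => ⟨n, le_trans (by exact_mod_cast h) hn⟩

variable (q : unitInterval)

lemma ae_step : ∀ᵐ w ∂walkLaw q, ∀ s, w s = -1 ∨ w s = 1 := by
  rw [ae_all_iff]
  intro s
  refine (measurePreserving_eval_infinitePi
    (fun _ : ℕ => bernoulliMeasure (-1 : ℤ) 1 q) s).quasiMeasurePreserving.ae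
    (p := fun z => z = -1 ∨ z = 1) ?_
  rw [ae_iff, bernoulliMeasure_apply_of_notMem_of_notMem] <;> simp

/-- The strong law of large numbers applies, with mean step `1 - 2 * q < 0`. -/
lemma ae_tendsto_atBot (hq : 1 / 2 < (q : ℝ)) :
    ∀ᵐ w ∂walkLaw q,
      Filter.Tendsto (fun n => ∑ s ∈ Finset.range n, w s) Filter.atTop Filter.atBot := by
  set X : ℕ → (ℕ → ℤ) → ℝ := fun s w => (w s : ℝ) with hX
  have hmp : ∀ s, MeasurePreserving (Function.eval s) (walkLaw q)
      (bernoulliMeasure (-1 : ℤ) 1 q) := fun s =>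
    measurePreserving_eval_infinitePi (fun _ : ℕ => bernoulliMeasure (-1 : ℤ) 1 q) s
  have hmeas : ∀ s, Measurable (X s) := fun s => by fun_prop
  have hint : Integrable (X 0) (walkLaw q) := by
    refine Integrable.of_bound (hmeas 0).aestronglyMeasurable 1 ?_
    filter_upwards [ae_step q] with w hw
    rcases hw 0 with h | h <;> simp [hX, h]
  have hindep : Pairwise fun i j => IndepFun (X i) (X j) (walkLaw q) := by
    intro i j hij
    exact (iIndepFun_infinitePi (P := fun _ : ℕ => bernoulliMeasure (-1 : ℤ) 1 q)
      (X := fun _ (z : ℤ) => (z : ℝ)) (fun _ => by fun_prop)).indepFun hij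
  have hident : ∀ i, IdentDistrib (X i) (X 0) (walkLaw q) (walkLaw q) := by
    intro i
    refine ⟨(hmeas i).aemeasurable, (hmeas 0).aemeasurable, ?_⟩
    have e : ∀ s, (walkLaw q).map (X s) =
        (bernoulliMeasure (-1 : ℤ) 1 q).map (fun z : ℤ => (z : ℝ)) := by
      intro s
      rw [← (hmp s).map_eq, Measure.map_map (by fun_prop) (by fun_prop)]
      rfl
    rw [e, e]
  have hmean : ∫ w, X 0 w ∂walkLaw q = 1 - 2 * q := by
    have h := integral_bernoulliMeasure (-1 : ℤ) 1 q (fun z : ℤ => (z : ℝ))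
    rw [← (hmp 0).map_eq, integral_map (hmp 0).measurable.aemeasurable (by fun_prop)] at h
    refine h.trans ?_
    simp
    ring
  filter_upwards [strong_law_ae_real X hint hindep hident] with w hw
  rw [hmean] at hw
  have h1 : Filter.Tendsto (fun n : ℕ => (n : ℝ) * ((∑ i ∈ Finset.range n, X i w) / n))
      Filter.atTop Filter.atBot :=
    tendsto_natCast_atTop_atTop.atTop_mul_neg (by linarith) hw
  rw [← tendsto_intCast_atBot_iff (R := ℝ)]
  refine h1.congr' ?_
  filter_upwards [Filter.eventually_gt_atTop 0] with n hn
  have : (n : ℝ) ≠ 0 := by exact_mod_cast hn.ne'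
  rw [mul_div_cancel₀ _ this]
  simp [hX]

lemma ae_exists_notMem_reach (hq : 1 / 2 < (q : ℝ)) : ∀ᵐ w ∂walkLaw q, ∃ k, w ∉ reach k := by
  filter_upwards [ae_tendsto_atBot q hq] with w hw
  rw [← Nat.cofinite_eq_atTop] at hw
  obtain ⟨m, hm⟩ := hw.exists_forall_ge
  refine ⟨(∑ s ∈ Finset.range m, w s).toNat + 1, ?_⟩
  rintro ⟨n, hn⟩
  have := hm n
  omega

/-- First-step analysis: the shifted walk is independent of the first step and has the same law. -/
lemma measureReal_reach_succ (k : ℕ) :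
    (walkLaw q).real (reach (k + 1)) =
      (1 - q) * (walkLaw q).real (reach k) + q * (walkLaw q).real (reach (k + 2)) := by
  set shift : (ℕ → ℤ) → ℕ → ℤ := fun w s => w (s + 1) with hshift
  have hms : Measurable shift := by fun_prop
  have hmap : (walkLaw q).map shift = walkLaw q :=
    Measure.map_infinitePi_infinitePi_of_inj
      (P := fun _ : ℕ => bernoulliMeasure (-1 : ℤ) 1 q) (add_left_injective 1)
  have hmp : MeasurePreserving (Function.eval 0) (walkLaw q) (bernoulliMeasure (-1 : ℤ) 1 q) :=
    measurePreserving_eval_infinitePi (fun _ : ℕ => bernoulliMeasure (-1 : ℤ) 1 q) 0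
  have hind : IndepFun (fun w : ℕ → ℤ => w 0) shift (walkLaw q) := by
    have hd : Disjoint ({0} : Set ℕ) (Set.Ici 1) := by simp
    have hφ : Measurable fun y : ({0} : Set ℕ) → ℤ => y ⟨0, rfl⟩ := measurable_pi_apply _
    exact (indepFun_restrict_infinitePi
      (fun _ : ℕ => bernoulliMeasure (-1 : ℤ) 1 q) hd).comp
      (ψ := fun y s => y ⟨s + 1, Nat.le_add_left 1 s⟩)
      hφ (by fun_prop)
  have hprod : ∀ (z : ℤ) (i : ℕ),
      (walkLaw q).real ((fun w : ℕ → ℤ => w 0) ⁻¹' {z} ∩ shift ⁻¹' reach i) =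
        (bernoulliMeasure (-1 : ℤ) 1 q).real {z} * (walkLaw q).real (reach i) := by
    intro z i
    rw [measureReal_def, hind.measure_inter_preimage_eq_mul _ _ (measurableSet_singleton z)
      (measurableSet_reach i), ENNReal.toReal_mul, ← Measure.map_apply hms (measurableSet_reach i),
      hmap]
    congr 2
    exact hmp.measure_preimage (measurableSet_singleton z).nullMeasurableSet
  have hsum : ∀ (w : ℕ → ℤ) (n : ℕ),
      ∑ s ∈ Finset.range (n + 1), w s = (∑ s ∈ Finset.range n, shift w s) + w 0 :=
    fun w n => Finset.sum_range_succ' _ _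
  have hae : reach (k + 1) =ᵐ[walkLaw q]
      (((fun w : ℕ → ℤ => w 0) ⁻¹' {1} ∩ shift ⁻¹' reach k) ∪
        ((fun w : ℕ → ℤ => w 0) ⁻¹' {-1} ∩ shift ⁻¹' reach (k + 2)) : Set (ℕ → ℤ)) := by
    filter_upwards [ae_step q] with w hw
    refine propext ?_
    show w ∈ reach (k + 1) ↔ w ∈ (_ : Set (ℕ → ℤ))
    have h1 : w ∈ reach (k + 1) ↔
        ∃ n, ((k + 1 : ℕ) : ℤ) ≤ (∑ s ∈ Finset.range n, shift w s) + w 0 := by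
      constructor
      · rintro ⟨n, hn⟩
        rcases n with _ | n
        · simp at hn
          omega
        · exact ⟨n, hsum w n ▸ hn⟩
      · rintro ⟨n, hn⟩
        exact ⟨n + 1, (hsum w n).symm ▸ hn⟩
    rw [h1]
    simp only [reach, Set.mem_inter_iff, Set.mem_preimage, Set.mem_singleton_iff,
      Set.mem_ofPred_eq]
    rcases hw 0 with h | h
    · rw [h]
      simp only [show ¬ ((-1 : ℤ) = 1) by norm_num, false_and, false_or, true_and]
      refine exists_congr fun n => ?_
      push_cast
      constructor <;> intro <;> linarith
    · rw [h]
      simp only [show ¬ ((1 : ℤ) = -1) by norm_num, false_and, or_false, true_and]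
      refine exists_congr fun n => ?_
      push_cast
      constructor <;> intro <;> linarith
  rw [measureReal_congr hae, measureReal_union, hprod, hprod,
    bernoulliMeasure_real_apply_of_notMem_of_mem, bernoulliMeasure_real_apply_of_mem_of_notMem]
  · simp
  all_goals first
    | simp
    | skip
  · rw [Set.disjoint_left]
    rintro w ⟨h1, -⟩ ⟨h2, -⟩
    simp only [Set.mem_preimage, Set.mem_singleton_iff] at h1 h2
    omega
  · exact ((measurable_pi_apply 0) (measurableSet_singleton _)).inter
      (hms (measurableSet_reach _))

/-- The probability that a walk with drift to the left gets `k` steps to the right. -/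
lemma measureReal_reach (hq : 1 / 2 < (q : ℝ)) (k : ℕ) :
    (walkLaw q).real (reach k) = ((1 - q) / q : ℝ) ^ k := by
  set h : ℕ → ℝ := fun k => (walkLaw q).real (reach k) with hh
  have hq0 : (0 : ℝ) < q := by linarith
  set r : ℝ := (1 - q) / q with hr
  have hr0 : 0 ≤ r := div_nonneg (by linarith [q.2.2]) hq0.le
  have hr1 : r < 1 := by rw [hr, div_lt_one hq0]; linarith
  have h0 : h 0 = 1 := by simp [hh, reach_zero]
  -- The recurrence makes the differences geometric, so `h` is determined by `h 0 = 1` and the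
  -- unknown `h 1`; the limit `0` at infinity then forces `h 1 = r`.
  have hstep : ∀ k, h (k + 1) - h (k + 2) = r * (h k - h (k + 1)) := by
    intro k
    have := measureReal_reach_succ q k
    change h (k + 1) = (1 - q) * h k + q * h (k + 2) at this
    rw [hr, div_mul_eq_mul_div, eq_div_iff hq0.ne']
    linarith
  have hdiff : ∀ k, h k - h (k + 1) = r ^ k * (1 - h 1) := by
    intro k
    induction k with
    | zero => simp [h0]
    | succ k ih => rw [hstep, ih]; ring
  have hval : ∀ k, (1 - r) * h k = (1 - r) - (1 - r ^ k) * (1 - h 1) := by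
    intro k
    induction k with
    | zero => simp [h0]
    | succ k ih =>
      have := hdiff k
      have e : h (k + 1) = h k - r ^ k * (1 - h 1) := by linarith
      rw [e, mul_sub, ih]
      ring
  have hlim : Filter.Tendsto h Filter.atTop (nhds 0) := by
    have ht := tendsto_measure_iInter_atTop (μ := walkLaw q) (s := reach)
      (fun i => (measurableSet_reach i).nullMeasurableSet) reach_antitone ⟨0, measure_ne_top _ _⟩
    have hz : walkLaw q (⋂ n, reach n) = 0 := by
      rw [measure_eq_zero_iff_ae_notMem]
      filter_upwards [ae_exists_notMem_reach q hq] with w ⟨k, hk⟩ hw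
      exact hk (Set.mem_iInter.1 hw k)
    rw [hz] at ht
    exact (ENNReal.tendsto_toReal ENNReal.zero_ne_top).comp ht
  have hlim2 : Filter.Tendsto (fun k => (1 - r) * h k) Filter.atTop
      (nhds ((1 - r) - (1 - 0) * (1 - h 1))) := by
    simp only [hval]
    exact ((tendsto_const_nhds.sub (tendsto_pow_atTop_nhds_zero_of_lt_one hr0 hr1)).mul_const
      _).const_sub _
  have heq := tendsto_nhds_unique hlim2 (hlim.const_mul (1 - r))
  have h1 : 1 - h 1 = 1 - r := by linarith
  have := hval k
  rw [h1] at this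
  have hne : 1 - r ≠ 0 := by linarith
  apply mul_left_cancel₀ hne
  rw [this]
  ring

lemma measure_compl_reach (hq : 1 / 2 < (q : ℝ)) (k : ℕ) :
    walkLaw q (reach k)ᶜ = ENNReal.ofReal (1 - ((1 - q) / q : ℝ) ^ k) := by
  rw [← ofReal_measureReal, probReal_compl_eq_one_sub (measurableSet_reach k),
    measureReal_reach q hq]

/-- A path with steps `±1` takes every value between its start and a later value to the right. -/
lemma exists_sum_eq_of_le {w : ℕ → ℤ} (hw : ∀ s, w s = -1 ∨ w s = 1) {k : ℤ} (hk : 0 ≤ k) {n : ℕ}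
    (hn : k ≤ ∑ s ∈ Finset.range n, w s) : ∃ m, ∑ s ∈ Finset.range m, w s = k := by
  induction n with
  | zero => exact ⟨0, le_antisymm (by simpa using hk) hn⟩
  | succ n ih =>
    rcases le_or_gt k (∑ s ∈ Finset.range n, w s) with h | h
    · exact ih h
    · refine ⟨n + 1, ?_⟩
      rw [Finset.sum_range_succ] at hn ⊢
      rcases hw n with h1 | h1 <;> omega

/-- A path with steps `±1` takes every value between its start and a later value to the left. -/
lemma exists_sum_eq_neg_of_le {w : ℕ → ℤ} (hw : ∀ s, w s = -1 ∨ w s = 1) {k : ℤ} (hk : 0 ≤ k)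
    {n : ℕ} (hn : ∑ s ∈ Finset.range n, w s ≤ -k) : ∃ m, ∑ s ∈ Finset.range m, w s = -k := by
  obtain ⟨m, hm⟩ := exists_sum_eq_of_le (w := fun s => -w s) (k := k) (n := n)
    (fun s => by rcases hw s with h | h <;> simp [h]) hk (by
      rw [Finset.sum_neg_distrib]; omega)
  rw [Finset.sum_neg_distrib] at hm
  exact ⟨m, by omega⟩

end Walk

/-! ### Deterministic link between barriers and the activation of frogs. -/

section Dynamics

/-- Some frog that starts at `j` would get `k` steps to the right. -/
def siteReach (ω : Sample) (j k : ℕ) : Prop :=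
  ∃ i < count ω j, (fun s => ω.2 ((j, i), s)) ∈ reach k

/-- The number of steps to the right that the frogs starting at `j` would get. -/
noncomputable def range (ω : Sample) (j : ℕ) : ℕ := sInf {k | ¬ siteReach ω j (k + 1)}

/-- All walks are nearest-neighbour and drift to the left. -/
structure Regular (ω : Sample) : Prop where
  step : ∀ f s, ω.2 (f, s) = -1 ∨ ω.2 (f, s) = 1
  drift : ∀ f, Filter.Tendsto (fun n => ∑ s ∈ Finset.range n, ω.2 (f, s)) Filter.atTop Filter.atBot
  bounded : ∀ f : Frog, ∃ k, (fun s => ω.2 (f, s)) ∉ reach k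

lemma siteReach_antitone (ω : Sample) (j : ℕ) {k l : ℕ} (h : k ≤ l) (hl : siteReach ω j l) :
    siteReach ω j k :=
  hl.imp fun _ hi => ⟨hi.1, reach_antitone h hi.2⟩

variable {ω : Sample}

/-- Finitely many frogs with bounded maxima keep the infimum in `range` from being over the empty
set. -/
lemma Regular.range_le_iff (hω : Regular ω) (j k : ℕ) :
    range ω j ≤ k ↔ ¬ siteReach ω j (k + 1) := by
  have hne : {k | ¬ siteReach ω j (k + 1)}.Nonempty := by
    choose b hb using fun i => hω.bounded (j, i)
    refine ⟨(Finset.range (count ω j)).sup b, ?_⟩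
    rintro ⟨i, hi, hr⟩
    have : b i ≤ (Finset.range (count ω j)).sup b := Finset.le_sup (Finset.mem_range.2 hi)
    exact hb i (reach_antitone (this.trans (Nat.le_succ _)) hr)
  refine ⟨fun h h2 => ?_, fun h => Nat.sInf_le h⟩
  have h1 : ¬ siteReach ω j (range ω j + 1) := Nat.sInf_mem hne
  exact h1 (siteReach_antitone ω j (Nat.succ_le_succ h) h2)

lemma age_succ_of_some {t k : ℕ} {f : Frog} (h : age ω t f = some k) :
    age ω (t + 1) f = some (k + 1) := by
  simp [age, h]

lemma age_add {t k : ℕ} {f : Frog} (h : age ω t f = some k) (n : ℕ) :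
    age ω (t + n) f = some (k + n) := by
  induction n with
  | zero => exact h
  | succ n ih => exact age_succ_of_some ih

lemma count_pos_of_age {t k : ℕ} {f : Frog} (h : age ω t f = some k) : f.2 < count ω f.1 := by
  induction t generalizing k with
  | zero =>
    rw [age] at h
    split_ifs at h with hf
    simp [hf, count]
  | succ t ih =>
    rcases ha : age ω t f with _ | l
    · simp only [age, ha] at h
      split_ifs at h with hf
      exact hf.1
    · exact ih ha

lemma exists_age_zero {t k : ℕ} {f : Frog} (h : age ω t f = some k) : ∃ t, age ω t f = some 0 := by
  induction t generalizing k with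
  | zero =>
    refine ⟨0, ?_⟩
    rw [age] at h ⊢
    split_ifs at h ⊢
    rfl
  | succ t ih =>
    rcases ha : age ω t f with _ | l
    · refine ⟨t + 1, ?_⟩
      simp only [age, ha] at h ⊢
      split_ifs at h ⊢
      rfl
    · exact ih ha

/-- The waking frog started in `[0, m]` by induction, so landing beyond `m` would contradict the
barrier. -/
lemma le_of_age_of_barrier (hω : Regular ω) {m : ℕ} (hm : range ω ∈ barrier 0 m) {t k : ℕ}
    {f : Frog} (h : age ω t f = some k) : f.1 ≤ m := by
  induction t generalizing k f with
  | zero =>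
    rw [age] at h
    split_ifs at h with hf
    simp [hf]
  | succ t ih =>
    rcases ha : age ω t f with _ | l
    · simp only [age, ha] at h
      split_ifs at h with hf
      obtain ⟨-, g, l, hg, hw⟩ := hf
      have hgm := ih hg
      have hb := hm g.1 (Nat.zero_le _) hgm
      by_contra! hlt
      refine (hω.range_le_iff g.1 (m - g.1)).1 (by omega) ⟨g.2, count_pos_of_age hg, l + 1, ?_⟩
      simp only [walk, Prod.mk.eta] at hw ⊢
      omega
    · exact ih ha

/-- If there is a barrier, then only finitely many frogs become active. -/
lemma finite_hitsOrigin_of_barrier (hω : Regular ω) {m : ℕ} (hm : range ω ∈ barrier 0 m) :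
    {f : Frog | HitsOrigin ω f}.Finite := by
  refine (((Finset.range (m + 1)).sigma fun j => Finset.range (count ω j)).map
    (Equiv.sigmaEquivProd ℕ ℕ).toEmbedding).finite_toSet.subset ?_
  rintro ⟨j, i⟩ ⟨t, k, ha, -⟩
  have h1 := le_of_age_of_barrier hω hm ha
  have h2 := count_pos_of_age ha
  simp only [Finset.coe_map, Set.mem_image, Finset.mem_coe, Finset.mem_sigma, Finset.mem_range]
  exact ⟨⟨j, i⟩, ⟨Nat.lt_succ_of_le h1, h2⟩, rfl⟩

/-- As `m` is no barrier, some frog from a site `j ≤ m` gets beyond `m`. It is active by induction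
and, moving by unit steps, lands on `m + 1`. -/
lemma exists_age_of_noBarrier (hω : Regular ω) (hb : range ω ∈ noBarrier 0) (j : ℕ) :
    ∀ i < count ω j, ∃ t, age ω t (j, i) = some 0 := by
  induction j using Nat.strong_induction_on with
  | _ j ih =>
    intro i hi
    rcases j with _ | m
    · refine ⟨0, ?_⟩
      have : i = 0 := by simpa [count] using hi
      simp [age, this]
    · have h1 := hb m (Nat.zero_le _)
      simp only [barrier, Set.mem_ofPred_eq] at h1
      push Not at h1
      obtain ⟨j, -, hjm, hj⟩ := h1
      have h2 : siteReach ω j (m - j + 1) := by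
        by_contra hn
        have := (hω.range_le_iff j (m - j)).2 hn
        omega
      obtain ⟨i', hi', n, hn⟩ := h2
      obtain ⟨n', hn'⟩ := exists_sum_eq_of_le (hω.step (j, i')) (by positivity) hn
      -- The landing needs at least one step, and `age` tests the position after `k + 1` steps.
      rcases n' with _ | n'
      · simp at hn'
        omega
      obtain ⟨t, ht⟩ := ih j (by omega) i' hi'
      have hg := age_add ht n'
      rw [zero_add] at hg
      have hw : walk ω (j, i') (n' + 1) = ((m + 1 : ℕ) : ℤ) := by
        simp only [walk]
        rw [hn']
        omega
      rcases ha : age ω (t + n') (m + 1, i) with _ | k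
      · refine ⟨t + n' + 1, ?_⟩
        simp only [age, ha]
        exact if_pos ⟨hi, _, _, hg, hw⟩
      · exact exists_age_zero ha

/-- If there is no barrier, then infinitely many frogs hit the origin. -/
lemma infinite_hitsOrigin_of_noBarrier (hω : Regular ω) (hb : range ω ∈ noBarrier 0) :
    {f : Frog | HitsOrigin ω f}.Infinite := by
  have hhit : ∀ f : Frog, f.2 < count ω f.1 → HitsOrigin ω f := by
    intro f hf
    obtain ⟨t, ht⟩ := exists_age_of_noBarrier hω hb f.1 f.2 hf
    obtain ⟨n, hn⟩ := (hω.drift f).eventually_le_atBot (-(f.1 : ℤ)) |>.exists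
    obtain ⟨k, hk⟩ := exists_sum_eq_neg_of_le (hω.step f) (by positivity) hn
    refine ⟨t + k, k, ?_, ?_⟩
    · simpa using age_add ht k
    · rw [walk, hk]
      omega
  intro hfin
  -- Every existing frog hits the origin, so finiteness would make this maximum a barrier; sites
  -- without frogs have range `0`.
  set m := hfin.toFinset.sup fun f => range ω f.1 + f.1 with hm
  refine hb m (Nat.zero_le _) fun j _ hj => ?_
  rcases Nat.eq_zero_or_pos (count ω j) with hc | hc
  · have : range ω j ≤ 0 := by
      rw [hω.range_le_iff]
      rintro ⟨i, hi, -⟩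
      omega
    omega
  · exact Finset.le_sup (f := fun f : Frog => range ω f.1 + f.1)
      (hfin.mem_toFinset.2 (hhit (j, 0) hc))

end Dynamics

/-! ### Independence and law of the ranges. -/

section Law

variable (ν : ℕ → Measure ℕ) [∀ j, IsProbabilityMeasure (ν j)] (p : ℕ → unitInterval)

instance : IsProbabilityMeasure (law ν p) := by
  unfold law; infer_instance

lemma measurePreserving_frog (f : Frog) :
    MeasurePreserving (fun (u : Frog × ℕ → ℤ) s => u (f, s))
      (Measure.infinitePi fun c : Frog × ℕ => bernoulliMeasure (-1 : ℤ) 1 (p c.1.1))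
      (walkLaw (p f.1)) :=
  ⟨by fun_prop, Measure.map_infinitePi_infinitePi_of_inj
    (P := fun c : Frog × ℕ => bernoulliMeasure (-1 : ℤ) 1 (p c.1.1)) (Prod.mk_right_injective f)⟩

lemma ae_regular (hp : ∀ j, 1 / 2 < (p j : ℝ)) : ∀ᵐ ω ∂law ν p, Regular ω := by
  have h : ∀ f : Frog, MeasurePreserving (fun (ω : Sample) s => ω.2 (f, s)) (law ν p)
      (walkLaw (p f.1)) := fun f =>
    (measurePreserving_frog p f).comp measurePreserving_snd
  have h1 := fun f => (h f).quasiMeasurePreserving.ae (ae_step (p f.1))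
  have h2 := fun f => (h f).quasiMeasurePreserving.ae (ae_tendsto_atBot (p f.1) (hp f.1))
  have h3 := fun f => (h f).quasiMeasurePreserving.ae (ae_exists_notMem_reach (p f.1) (hp f.1))
  filter_upwards [ae_all_iff.2 h1, ae_all_iff.2 h2, ae_all_iff.2 h3] with ω h1 h2 h3
  exact ⟨h1, h2, h3⟩

lemma measurable_count (j : ℕ) : Measurable fun ω : Sample => count ω j := by
  unfold count
  split_ifs <;> fun_prop

lemma measurableSet_siteReach (j k : ℕ) : MeasurableSet {ω | siteReach ω j k} := by
  have : {ω | siteReach ω j k} = ⋃ i, {ω : Sample | i < count ω j} ∩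
      (fun (ω : Sample) s => ω.2 ((j, i), s)) ⁻¹' reach k := by
    ext ω; simp [siteReach]
  rw [this]
  have := measurable_count j
  exact MeasurableSet.iUnion fun i => (measurableSet_lt measurable_const this).inter
    ((by fun_prop : Measurable fun (ω : Sample) s => ω.2 ((j, i), s)) (measurableSet_reach k))

lemma measurable_range : Measurable range :=
  measurable_pi_lambda _ fun j =>
    measurable_sInf_setOf_mem (P := fun k => {ω | ¬ siteReach ω j (k + 1)})
      fun k => (measurableSet_siteReach j (k + 1)).compl

/-- The probability that no frog starting at `j` would get `k` steps to the right. -/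
noncomputable def avoidProb (j k : ℕ) : ENNReal :=
  ∫⁻ n, (walkLaw (p j) (reach k)ᶜ) ^ (if j = 0 then 1 else n) ∂ν j

/-- Given the numbers of frogs, distinct frogs have independent paths, which gives a product of
powers. The independent numbers are then integrated out. -/
lemma law_forall_not_siteReach (J : Finset ℕ) (k : ℕ → ℕ) :
    law ν p {ω | ∀ j ∈ J, ¬ siteReach ω j (k j)} = ∏ j ∈ J, avoidProb ν p j (k j) := by
  have hm : MeasurableSet {ω | ∀ j ∈ J, ¬ siteReach ω j (k j)} := by
    have : {ω | ∀ j ∈ J, ¬ siteReach ω j (k j)} = ⋂ j ∈ J, {ω | siteReach ω j (k j)}ᶜ := by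
      ext ω; simp
    rw [this]
    exact Finset.measurableSet_biInter _ fun j _ => (measurableSet_siteReach j (k j)).compl
  rw [law, Measure.prod_apply hm]
  have hinner : ∀ x : ℕ → ℕ,
      (Measure.infinitePi fun c : Frog × ℕ => bernoulliMeasure (-1 : ℤ) 1 (p c.1.1))
        (Prod.mk x ⁻¹' {ω | ∀ j ∈ J, ¬ siteReach ω j (k j)}) =
      ∏ j ∈ J, (walkLaw (p j) (reach (k j))ᶜ) ^ (if j = 0 then 1 else x j) := by
    intro x
    set c : ℕ → ℕ := fun j => if j = 0 then 1 else x j with hc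
    set T : Finset Frog := (J.sigma fun j => Finset.range (c j)).map
      (Equiv.sigmaEquivProd ℕ ℕ).toEmbedding with hT
    -- Currying regroups the independent steps into independent paths, one for each frog.
    have hcurry := Measure.infinitePi_map_curry
      (fun (f : Frog) (_ : ℕ) => bernoulliMeasure (-1 : ℤ) 1 (p f.1))
    have hpre : Prod.mk x ⁻¹' {ω | ∀ j ∈ J, ¬ siteReach ω j (k j)} =
        MeasurableEquiv.curry Frog ℕ ℤ ⁻¹'
          (Set.pi (T : Set Frog) fun f => (reach (k f.1))ᶜ) := by
      ext u
      simp only [Set.mem_preimage, Set.mem_ofPred_eq, siteReach, Set.mem_pi, hT, Finset.coe_map,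
        Set.mem_image, Finset.mem_coe, Finset.mem_sigma, Finset.mem_range, Set.mem_compl_iff]
      constructor
      · rintro h f ⟨⟨j, i⟩, ⟨hj, hi⟩, rfl⟩ hr
        exact h j hj ⟨i, hi, hr⟩
      · rintro h j hj ⟨i, hi, hr⟩
        exact h (j, i) ⟨⟨j, i⟩, ⟨hj, hi⟩, rfl⟩ hr
    rw [hpre, ← MeasurableEquiv.map_apply, hcurry, Measure.infinitePi_pi _
      (fun f _ => (measurableSet_reach _).compl), hT, Finset.prod_map, Finset.prod_sigma]
    refine Finset.prod_congr rfl fun j _ => ?_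
    show ∏ _i ∈ Finset.range (c j), walkLaw (p j) (reach (k j))ᶜ = _
    rw [Finset.prod_const, Finset.card_range]
  simp only [hinner]
  rw [lintegral_prod_eq_prod_lintegral_of_indepFun J
    (fun j (x : ℕ → ℕ) => (walkLaw (p j) (reach (k j))ᶜ) ^ (if j = 0 then 1 else x j))
    (iIndepFun_infinitePi
      (X := fun j (n : ℕ) => (walkLaw (p j) (reach (k j))ᶜ) ^ (if j = 0 then 1 else n))
      fun j => measurable_of_countable _)
    (fun j => (measurable_of_countable
      fun n : ℕ => (walkLaw (p j) (reach (k j))ᶜ) ^ (if j = 0 then 1 else n)).comp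
        (measurable_pi_apply j))]
  refine Finset.prod_congr rfl fun j _ => ?_
  exact (measurePreserving_eval_infinitePi ν j).lintegral_comp
    (f := fun n : ℕ => (walkLaw (p j) (reach (k j))ᶜ) ^ (if j = 0 then 1 else n))
    (measurable_of_countable _)

/-- The law of the range of the site `j`. -/
noncomputable def rangeLaw (j : ℕ) : Measure ℕ := (law ν p).map fun ω => range ω j

lemma measurable_range_apply (j : ℕ) : Measurable fun ω => range ω j :=
  (measurable_pi_apply j).comp measurable_range

instance (j : ℕ) : IsProbabilityMeasure (rangeLaw ν p j) :=
  Measure.isProbabilityMeasure_map (measurable_range_apply j).aemeasurable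

lemma law_forall_range_le (hp : ∀ j, 1 / 2 < (p j : ℝ)) (J : Finset ℕ) (k : ℕ → ℕ) :
    law ν p {ω | ∀ j ∈ J, range ω j ≤ k j} = ∏ j ∈ J, avoidProb ν p j (k j + 1) := by
  rw [← law_forall_not_siteReach ν p J fun j => k j + 1]
  refine measure_congr ?_
  filter_upwards [ae_regular ν p hp] with ω hω
  refine propext ?_
  show (∀ j ∈ J, range ω j ≤ k j) ↔ ∀ j ∈ J, ¬ siteReach ω j (k j + 1)
  simp only [hω.range_le_iff]

lemma rangeLaw_Iic (hp : ∀ j, 1 / 2 < (p j : ℝ)) (j k : ℕ) :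
    rangeLaw ν p j (Set.Iic k) = avoidProb ν p j (k + 1) := by
  have h := law_forall_range_le ν p hp {j} fun _ => k
  rw [Finset.prod_singleton] at h
  rw [← h, rangeLaw, Measure.map_apply (measurable_range_apply j) measurableSet_Iic]
  congr 1
  ext ω
  simp

lemma map_range_law (hp : ∀ j, 1 / 2 < (p j : ℝ)) :
    (law ν p).map range = Measure.infinitePi (rangeLaw ν p) := by
  refine eq_infinitePi_of_forall_le _ fun J k => ?_
  simp only [rangeLaw_Iic ν p hp]
  rw [← law_forall_range_le ν p hp, Measure.map_apply measurable_range]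
  · rfl
  · have : {x : ℕ → ℕ | ∀ j ∈ J, x j ≤ k j} = ⋂ j ∈ J, {x : ℕ → ℕ | x j ≤ k j} := by
      ext ω; simp
    rw [this]
    exact Finset.measurableSet_biInter _ fun j _ => measurableSet_le (by fun_prop) measurable_const

end Law

/-! ### Poisson numbers of frogs and the criterion in terms of `reachMean`. -/

lemma lintegral_pow_poissonMeasure (r : NNReal) {b : ℝ} (hb0 : 0 ≤ b) (hb1 : b ≤ 1) :
    ∫⁻ n, ENNReal.ofReal b ^ n ∂poissonMeasure r = ENNReal.ofReal (Real.exp (-(r * (1 - b)))) := by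
  have hint : Integrable (fun n : ℕ => b ^ n) (poissonMeasure r) := by
    refine Integrable.of_bound (measurable_of_countable _).aestronglyMeasurable 1
      (Filter.Eventually.of_forall fun n => ?_)
    rw [Real.norm_of_nonneg (by positivity)]
    exact pow_le_one₀ hb0 hb1
  have h1 : ∫⁻ n, ENNReal.ofReal b ^ n ∂poissonMeasure r =
      ENNReal.ofReal (∫ n : ℕ, b ^ n ∂poissonMeasure r) := by
    rw [ofReal_integral_eq_lintegral_ofReal hint (Filter.Eventually.of_forall fun n => by positivity)]
    simp only [ENNReal.ofReal_pow hb0]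
  rw [h1, integral_poissonMeasure]
  congr 1
  have h2 : HasSum (fun n : ℕ => Real.exp (-r) * ((r * b) ^ n / n.factorial))
      (Real.exp (-r) * Real.exp (r * b)) := by
    refine HasSum.mul_left _ ?_
    rw [Real.exp_eq_exp_ℝ]
    exact NormedSpace.exp_series_hasSum_exp' (𝕂 := ℝ) (r * b : ℝ) |>.congr_fun fun n => by
      rw [smul_eq_mul]; ring
  rw [← Real.exp_add] at h2
  rw [show -((r : ℝ) * (1 - b)) = -r + r * b by ring, ← h2.tsum_eq]
  refine tsum_congr fun n => ?_
  rw [smul_eq_mul, mul_pow]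
  ring

lemma tsum_ofReal_eq_top_iff {f : ℕ → ℝ} (hf : ∀ n, 0 ≤ f n) :
    ∑' n, ENNReal.ofReal (f n) = ⊤ ↔ ¬ Summable f := by
  refine ⟨fun h hs => hs.tsum_ofReal_ne_top h, fun h => ?_⟩
  by_contra hne
  refine h ((ENNReal.summable_toReal hne).congr fun n => ?_)
  exact ENNReal.toReal_ofReal (hf n)

section Ranges

variable (lam : ℕ → NNReal) (p : ℕ → unitInterval)

lemma one_sub_div_nonneg {q : unitInterval} (hq : 1 / 2 < (q : ℝ)) : 0 ≤ (1 - q) / (q : ℝ) :=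
  div_nonneg (by linarith [q.2.2]) (by linarith)

lemma one_sub_div_le_one {q : unitInterval} (hq : 1 / 2 < (q : ℝ)) : (1 - q) / (q : ℝ) ≤ 1 := by
  rw [div_le_one (by linarith)]
  linarith

lemma rangeLaw_zero_Iic (ν : ℕ → Measure ℕ) [∀ j, IsProbabilityMeasure (ν j)]
    (hp : ∀ j, 1 / 2 < (p j : ℝ)) (k : ℕ) :
    rangeLaw ν p 0 (Set.Iic k) = ENNReal.ofReal (1 - ((1 - p 0) / p 0 : ℝ) ^ (k + 1)) := by
  rw [rangeLaw_Iic ν p hp, avoidProb]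
  simp [measure_compl_reach (p 0) (hp 0)]

lemma rangeLaw_poisson_Iic (hp : ∀ j, 1 / 2 < (p j : ℝ)) {j : ℕ} (hj : j ≠ 0) (k : ℕ) :
    rangeLaw (fun j => poissonMeasure (lam j)) p j (Set.Iic k) =
      ENNReal.ofReal (Real.exp (-(lam j * ((1 - p j) / p j : ℝ) ^ (k + 1)))) := by
  rw [rangeLaw_Iic _ p hp, avoidProb]
  simp only [hj, if_false, measure_compl_reach (p j) (hp j)]
  have h0 := one_sub_div_nonneg (hp j)
  have h1 := one_sub_div_le_one (hp j)
  rw [lintegral_pow_poissonMeasure _ (sub_nonneg.2 (pow_le_one₀ h0 h1))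
    (sub_le_self _ (pow_nonneg h0 _)), sub_sub_cancel]

lemma rangeLaw_zero_Ici_ne_zero (ν : ℕ → Measure ℕ) [∀ j, IsProbabilityMeasure (ν j)]
    (hp : ∀ j, 1 / 2 < (p j : ℝ)) (hp0 : (p 0 : ℝ) < 1) (N : ℕ) :
    rangeLaw ν p 0 (Set.Ici N) ≠ 0 := by
  intro h
  have h1 : (1 : ENNReal) ≤ rangeLaw ν p 0 (Set.Iic N) := by
    calc (1 : ENNReal) = rangeLaw ν p 0 (Set.Iic N ∪ Set.Ici N) := by
          rw [Set.Iic_union_Ici, measure_univ]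
      _ ≤ rangeLaw ν p 0 (Set.Iic N) + rangeLaw ν p 0 (Set.Ici N) := measure_union_le _ _
      _ = _ := by rw [h, add_zero]
  rw [rangeLaw_zero_Iic p ν hp, ENNReal.one_le_ofReal] at h1
  have : 0 < ((1 - p 0) / p 0 : ℝ) ^ (N + 1) :=
    pow_pos (div_pos (by linarith) (by linarith [hp 0])) _
  linarith

/-- A barrier at `m + 1` forbids site `j` to get `m + 2 - j` steps to the right. The substitution `i
= m + 1 - j` gives the exponent `i + 1` in `reachMean`, whose index `m - i` stands for the site `m -
i + 1 = j`. -/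
lemma infinitePi_rangeLaw_barrier (hp : ∀ j, 1 / 2 < (p j : ℝ)) {x : ℕ → ℝ}
    (hx : ∀ j, ((1 - p (j + 1)) / p (j + 1) : ℝ) = x j / (1 + x j)) (m : ℕ) :
    Measure.infinitePi (rangeLaw (fun j => poissonMeasure (lam j)) p) (barrier 1 (m + 1)) =
      ENNReal.ofReal (Real.exp (-reachMean (fun j => (lam (j + 1) : ℝ)) x m)) := by
  rw [infinitePi_barrier, reachMean, ← Finset.sum_neg_distrib, Real.exp_sum,
    ENNReal.ofReal_prod_of_nonneg fun i _ => (Real.exp_pos _).le]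
  refine Finset.prod_nbij' (fun j => m + 1 - j) (fun i => m + 1 - i) ?_ ?_ ?_ ?_ ?_
  · intro j hj
    simp only [Finset.mem_Icc, Finset.mem_range] at hj ⊢
    omega
  · intro i hi
    simp only [Finset.mem_Icc, Finset.mem_range] at hi ⊢
    omega
  · intro j hj
    simp only [Finset.mem_Icc] at hj
    omega
  · intro i hi
    simp only [Finset.mem_range] at hi
    omega
  · intro j hj
    simp only [Finset.mem_Icc] at hj
    rw [rangeLaw_poisson_Iic lam p hp (by omega)]
    obtain ⟨i, rfl⟩ : ∃ i, j = i + 1 := ⟨j - 1, by omega⟩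
    rw [show m - (m + 1 - (i + 1)) = i by omega, hx]

lemma transient_iff (hp : ∀ j, 1 / 2 < (p j : ℝ)) (hp0 : (p 0 : ℝ) < 1) {x : ℕ → ℝ}
    (hx : ∀ j, ((1 - p (j + 1)) / p (j + 1) : ℝ) = x j / (1 + x j)) (hxc : PosConcave x)
    (hlc : PosConcave fun j => (lam (j + 1) : ℝ)) :
    Transient (fun j => poissonMeasure (lam j)) p ↔
      ¬ Summable fun m => Real.exp (-reachMean (fun j => (lam (j + 1) : ℝ)) x m) := by
  set ν : ℕ → Measure ℕ := fun j => poissonMeasure (lam j) with hν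
  rw [← tsum_ofReal_eq_top_iff fun n => (Real.exp_pos _).le]
  simp only [← infinitePi_rangeLaw_barrier lam p hp hx]
  constructor
  · intro ht
    by_contra hne
    refine infinitePi_noBarrier_zero_pos (rangeLaw ν p) hne
      (rangeLaw_zero_Ici_ne_zero p ν hp hp0) ?_
    rw [← map_range_law ν p hp, Measure.map_apply measurable_range (measurableSet_noBarrier 0)]
    refine measure_mono_null_ae ?_ ht
    filter_upwards [ae_regular ν p hp] with ω hω hb
    exact infinite_hitsOrigin_of_noBarrier hω hb
  · intro hsum
    -- Positive concave sequences increase, so both the frog density and the ratio `r_j` grow with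
    -- the site.
    have hmono : ∀ i k, rangeLaw ν p (i + 2) (Set.Iic k) ≤ rangeLaw ν p (i + 1) (Set.Iic k) := by
      intro i k
      rw [rangeLaw_poisson_Iic lam p hp (by omega), rangeLaw_poisson_Iic lam p hp (by omega)]
      refine ENNReal.ofReal_le_ofReal (Real.exp_le_exp.2 (neg_le_neg ?_))
      have h1 : (lam (i + 1) : ℝ) ≤ lam (i + 2) := hlc.monotone (Nat.le_succ i)
      have h2 : ((1 - p (i + 1)) / p (i + 1) : ℝ) ≤ (1 - p (i + 2)) / p (i + 2) := by
        rw [hx i, hx (i + 1)]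
        exact ratio_le_ratio (hxc.pos i) (hxc.monotone (Nat.le_succ i))
      have h3 := one_sub_div_nonneg (hp (i + 1))
      gcongr
    have hae := ae_exists_barrier (rangeLaw ν p) hmono hsum
    rw [← map_range_law ν p hp] at hae
    rw [Transient, measure_eq_zero_iff_ae_notMem]
    filter_upwards [ae_regular ν p hp, ae_of_ae_map measurable_range.aemeasurable hae]
      with ω hω ⟨m, hm⟩ hinf
    exact hinf (finite_hitsOrigin_of_barrier hω hm)

end Ranges

end FrogModel

/-! ### The criterion in terms of `a`. -/

theorem theorem3p2 (lam : ℕ → NNReal) (p : ℕ → unitInterval) (a : ℕ → ℝ)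
    (hlam : ∀ j, 1 ≤ j → 0 < lam j)
    (hp : ∀ j, 1 / 2 < (p j : ℝ) ∧ (p j : ℝ) < 1)
    (hpa : ∀ j, 1 ≤ j → (p j : ℝ) = 1 / 2 + a j)
    (ha_concave : FrogModel.ConcaveSeq fun j => 1 / a j)
    (hlam_concave : FrogModel.ConcaveSeq fun j => (lam j : ℝ)) :
    FrogModel.Transient (fun j => poissonMeasure (lam j)) p ↔
      ∑' n : ℕ, ENNReal.ofReal
        (Real.exp (-((lam (n + 1) : ℝ) * (1 / (4 * a (n + 1)) - 1 / 2)))) = ⊤ := by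
  have ha : ∀ j, 0 < a (j + 1) ∧ a (j + 1) < 1 / 2 := by
    intro j
    have h1 := hp (j + 1)
    rw [hpa (j + 1) (Nat.le_add_left 1 j)] at h1
    constructor <;> linarith
  -- This solves `r = x / (1 + x)`, so `x = r / (1 - r)` is the mean maximal displacement of one
  -- frog. Being affine in `1 / a`, it inherits concavity.
  set x : ℕ → ℝ := fun j => 1 / (4 * a (j + 1)) - 1 / 2 with hx
  have hxc : FrogModel.PosConcave x := by
    refine ⟨fun j => ?_, fun j => ?_⟩
    · have h := ha j
      rw [hx, sub_pos, div_lt_div_iff₀ (by norm_num) (by linarith)]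
      linarith
    · have h := ha_concave (j + 1) (Nat.le_add_left 1 j)
      have e : ∀ i, x i = 1 / 4 * (1 / a (i + 1)) - 1 / 2 := by
        intro i
        simp only [hx]
        rw [one_div_mul_one_div]
      rw [e, e, e]
      simp only at h
      rw [show j + 2 + 1 = j + 1 + 2 by omega]
      linarith
  have hlc : FrogModel.PosConcave fun j => (lam (j + 1) : ℝ) :=
    ⟨fun j => NNReal.coe_pos.2 (hlam _ (Nat.le_add_left 1 j)),
      fun j => hlam_concave (j + 1) (Nat.le_add_left 1 j)⟩
  have hr : ∀ j, ((1 - p (j + 1)) / p (j + 1) : ℝ) = x j / (1 + x j) := by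
    intro j
    have h := ha j
    have hx0 := hxc.pos j
    rw [div_eq_div_iff (by linarith [(hp (j + 1)).1]) (by linarith),
      hpa (j + 1) (Nat.le_add_left 1 j)]
    simp only [hx]
    have := h.1.ne'
    field_simp
    ring
  rw [FrogModel.transient_iff lam p (fun j => (hp j).1) (hp 0).2 hr hxc hlc,
    FrogModel.summable_exp_neg_reachMean_iff hlc hxc,
    FrogModel.tsum_ofReal_eq_top_iff fun n => (Real.exp_pos _).le]
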